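/- **Setting.** An episodic multi-objective MDP has a finite state space $\mathcal S$, a finite non-empty action space $\mathcal A$, horizon $H\ge 1$, $m$ objectives, unknown transition probabilities $\mathbb P_h(s'\mid s,a)$, unknown mean rewards $r_{i,h}(s,a)\in[0,1]$ ($i\in[m]$, $h\in[H]$) and a fixed initial state $s_1$. When $a$ is played in $s$ at step $h$, the observed rewards lie in $[0,1]$ and have conditional mean $r_{i,h}(s,a)$ given the past, and the next state has conditional law $\mathbb P_h(\cdot\mid s,a)$. $\Pi$ is the class of stochastic policies $\pi_h(a\mid s)$, $V_{i,1}^\pi(s_1)$ is the expected total $i$-th reward of $\pi$, and $V^*_{i,1}(s_1)=\max_{\pi\in\Pi}V^\pi_{i,1}(s_1)$. For $\lambda$ in the simplex $\Delta_m$ and a fixed $\iota\in(0,1]$, $$\mathrm{TCH}_\lambda(\pi)=\max_{i\in[m]}\lambda_i\bigl(V_{i,1}^*(s_1)+\iota-V_{i,1}^\pi(s_1)\bigr).$$ **Algorithm TchRL** ($T\ge1$ rounds, $\delta\in(0,1)$, $\eta=\sqrt{\log m/(H^2T)}$). Put $w_i^0=1/m$ and $V^0=\tilde V^0=0$. In round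 $t=1,\dots,T$: 1. $w_i^t\propto w_i^{t-1}\exp\{\eta\lambda_i(\tilde V_{i,1}^{t-1}(s_1)+\iota-V_{i,1}^{t-1}(s_1))\}$. 2. With $V^t_{i,H+1}=\tilde V^t_{i,H+1}=0$, for $h=H,\dots,1$ and all $i$: $\tilde Q^t_{i,h}=\mathrm{OptQ}(\tilde{\mathcal D}_i,\tilde V^t_{i,h+1})$; $\tilde\nu^t_{i,h}(\cdot\mid s)$ maximizes $\langle\tilde Q^t_{i,h}(s,\cdot),p\rangle$ over distributions $p$ on $\mathcal A$; $\tilde V^t_{i,h}(s)=\langle\tilde Q^t_{i,h}(s,\cdot),\tilde\nu^t_{i,h}(\cdot\mid s)\rangle$; $Q^t_{i,h}=\mathrm{OptQ}(\mathcal D_i,V^t_{i,h+1})$; $\pi^t_h(\cdot\mid s)$ maximizes $\langle\sum_i w_i^t\lambda_iQ^t_{i,h}(s,\cdot),p\rangle$ over $p$; $V^t_{i,h}(s)=\langle Q^t_{i,h}(s,\cdot),\pi^t_h(\cdot\mid s)\rangle$. Ties are broken arbitrarily, without anticipating the future. 3. For each $i$, sample an episode with $\tilde\nu_i^t$, observe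 its $i$-th rewards and append it to $\tilde{\mathcal D}_i$; sample one episode with $\pi^t$, observe all $m$ rewards and append it to every $\mathcal D_i$. Here $\mathrm{OptQ}(\mathcal D_i,V)(s,a)=\min\{\max\{\hat r_{i,h}+\sum_{s'}\hat{\mathbb P}_h(s'\mid s,a)V(s')+\Phi_h+\Psi_h,\,0\},\,H-h+1\}$, where $N=\max\{N_h(s,a),1\}$ for the number $N_h(s,a)$ of visits of $(s,a)$ at step $h$ in the data of the earlier rounds, $\hat r_{i,h}$ is the sum of the observed $i$-th rewards at these visits divided by $N$, $\hat{\mathbb P}_h(s'\mid s,a)$ is the number of visits followed by $s'$ divided by $N$, $\Psi_h=\min\{\sqrt{2L/N},1\}$, $\Phi_h=\min\{\sqrt{2H^2|\mathcal S|L/N},H\}$ and $L=\log(8m|\mathcal S||\mathcal A|HT/\delta)$. Let $\hat\pi$ be the uniform mixture of $\pi^1,\dots,\pi^T$: draw $t\in[T]$ uniformly once and follow $\pi^t$ for the whole episode. **Theorem.** There is a universal constant $C>0$ such that for every such MDP, every $\lambda\in\Delta_m$, $\iota\in(0,1]$ and $\delta\in(0,1)$: (i) $\mathrm{TCH}_\lambda$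 has a minimizer $\pi^*_\lambda$ over $\Pi$, and for every $T\ge1$, after $T$ rounds of TchRL, with probability at least $1-\delta$, $$\mathrm{TCH}_\lambda(\hat\pi)-\mathrm{TCH}_\lambda(\pi^*_\lambda)\le C\sqrt{\frac{H^4|\mathcal S|^2|\mathcal A|\log(m|\mathcal S||\mathcal A|HT/\delta)}{T}}.$$ (ii) For every $\varepsilon\in(0,1]$ there is $T_0\ge1$ such that for every $T\ge T_0$ the output after $T$ rounds satisfies $\mathrm{TCH}_\lambda(\hat\pi)-\mathrm{TCH}_\lambda(\pi^*_\lambda)\le\varepsilon$ with probability at least $1-\delta$, and the number $(m+1)T_0$ of episodes sampled in $T_0$ rounds is at most $$C\,\frac{mH^4|\mathcal S|^2|\mathcal A|}{\varepsilon^2}\log\frac{2m|\mathcal S||\mathcal A|H}{\varepsilon\delta},$$ that is, the sample complexity is $\tilde O(mH^4|\mathcal S|^2|\mathcal A|/\varepsilon^2)$. -/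

import Mathlib

open MeasureTheory ProbabilityTheory

/-- An episodic multi-objective Markov decision process with state space `S`, action space `A`,
episode length `H` and `m` objectives: a time-dependent transition kernel, `m` time-dependent mean
reward functions with values in `[0,1]`, and a fixed initial state. The steps `1, …, H` are indexed
by `Fin H`, i.e. by `0, …, H - 1`. -/
structure MOMDP (S A : Type*) [Fintype S] (H m : ℕ) where
  trans : Fin H → S → A → S → ℝ
  trans_mem : ∀ h s a, trans h s a ∈ stdSimplex ℝ S
  reward : Fin m → Fin H → S → A → ℝ
  reward_mem : ∀ i h s a, reward i h s a ∈ Set.Icc (0 : ℝ) 1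
  init : S

/-- Stochastic (Markov) policies: `π h s a` is the probability of action `a` in state `s` at
step `h`. -/
abbrev Policy (S A : Type*) [Fintype A] (H : ℕ) : Type _ :=
  {π : Fin H → S → A → ℝ // ∀ h s, π h s ∈ stdSimplex ℝ A}

/-- State-action trajectories `(s_1, …, s_{H+1}), (a_1, …, a_H)`. -/
abbrev Traj (S A : Type*) (H : ℕ) : Type _ := (Fin (H + 1) → S) × (Fin H → A)

section Values

variable {S A : Type*} [Fintype S] [DecidableEq S] [Fintype A] {H m : ℕ}

/-- The probability of a trajectory when `π` is run in `M` from the initial state. -/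
noncomputable def trajLaw (M : MOMDP S A H m) (π : Policy S A H) (x : Traj S A H) : ℝ :=
  (if x.1 0 = M.init then 1 else 0) *
    ∏ h : Fin H, (π.1 h (x.1 h.castSucc) (x.2 h) *
      M.trans h (x.1 h.castSucc) (x.2 h) (x.1 h.succ))

/-- The trajectory law of the uniform mixture of `π 1, …, π T`: an index in `{1, …, T}` is drawn
uniformly beforehand and the corresponding policy is followed for the whole episode. -/
noncomputable def mixLaw (M : MOMDP S A H m) (T : ℕ) (π : ℕ → Policy S A H)
    (x : Traj S A H) : ℝ :=
  ∑ t ∈ Finset.Icc 1 T, (1 / (T : ℝ)) * trajLaw M (π t) x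

/-- The expected total `i`-th reward of an episode with the given trajectory law. -/
noncomputable def expReturn (M : MOMDP S A H m) (i : Fin m) (law : Traj S A H → ℝ) : ℝ :=
  ∑ x : Traj S A H, law x * ∑ h : Fin H, M.reward i h (x.1 h.castSucc) (x.2 h)

/-- The value `V_{i,1}^π(s_1)`. -/
noncomputable def value (M : MOMDP S A H m) (i : Fin m) (π : Policy S A H) : ℝ :=
  expReturn M i (trajLaw M π)

/-- The optimal value `V_{i,1}^*(s_1)` of the `i`-th objective over all stochastic policies. -/
noncomputable def optValue (M : MOMDP S A H m) (i : Fin m) : ℝ :=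
  ⨆ π : Policy S A H, value M i π

/-- Tchebycheff scalarization, for a (possibly mixed) policy with the given trajectory law:
the maximum over `i` of `λ_i (V_{i,1}^*(s_1) + ι - V_{i,1}(s_1))`. -/
noncomputable def tchLaw (M : MOMDP S A H m) (lam : Fin m → ℝ) (ι : ℝ)
    (law : Traj S A H → ℝ) : ℝ :=
  ⨆ i : Fin m, lam i * (optValue M i + ι - expReturn M i law)

/-- `TCH_λ(π)` for a policy `π`. -/
noncomputable def tch (M : MOMDP S A H m) (lam : Fin m → ℝ) (ι : ℝ) (π : Policy S A H) : ℝ :=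
  tchLaw M lam ι (trajLaw M π)

/-- `TCH_λ(π̂)` for the uniform mixture `π̂` of `π 1, …, π T`. -/
noncomputable def tchMix (M : MOMDP S A H m) (lam : Fin m → ℝ) (ι : ℝ) (T : ℕ)
    (π : ℕ → Policy S A H) : ℝ :=
  tchLaw M lam ι (mixLaw M T π)

end Values

/-- The observations made in one episode: states, actions and, for each `j : J`, a real reward at
each step. -/
structure Episode (S A J : Type*) (H : ℕ) where
  state : Fin (H + 1) → S
  action : Fin H → A
  reward : J → Fin H → ℝ

section Sampling

variable {S A J Ω : Type*} [MeasurableSpace S] [MeasurableSpace A] {H m : ℕ}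

/-- The information available just before the action of step `h`: the prior information `𝒢` and the
states up to step `h`, the actions and the rewards of the steps before `h`. -/
@[reducible] def preAction (𝒢 : MeasurableSpace Ω) (E : Ω → Episode S A J H) (h : Fin H) :
    MeasurableSpace Ω :=
  𝒢 ⊔ (⨆ k : {k : Fin (H + 1) // k ≤ h.castSucc},
        MeasurableSpace.comap (fun ω => (E ω).state k) inferInstance)
    ⊔ (⨆ k : {k : Fin H // k < h},
        MeasurableSpace.comap (fun ω => (E ω).action k) inferInstance)
    ⊔ (⨆ k : {k : Fin H // k < h}, ⨆ j : J,
        MeasurableSpace.comap (fun ω => (E ω).reward j k) inferInstance)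

/-- The information available just after the action of step `h` has been taken. -/
@[reducible] def postAction (𝒢 : MeasurableSpace Ω) (E : Ω → Episode S A J H) (h : Fin H) :
    MeasurableSpace Ω :=
  preAction 𝒢 E h ⊔ MeasurableSpace.comap (fun ω => (E ω).action h) inferInstance

/-- `E` is an episode sampled from `M` by the policy `π`, which is chosen on the basis of the
information `𝒢` available before the episode; `𝒢'` is the information available afterwards.
Reward `j` is a noisy observation, with values in `[0,1]`, of the reward function of the
objective `obs j`. -/
structure IsSampled [Fintype S] [DecidableEq S] [Fintype A] [DecidableEq A] [mΩ : MeasurableSpace Ω]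
    (M : MOMDP S A H m) (obs : J → Fin m) (μ : Measure Ω) (𝒢 𝒢' : MeasurableSpace Ω)
    (π : Ω → Policy S A H) (E : Ω → Episode S A J H) : Prop where
  policy_measurable : ∀ h s a, Measurable[𝒢] fun ω => (π ω).1 h s a
  state_measurable : ∀ h, Measurable[𝒢'] fun ω => (E ω).state h
  action_measurable : ∀ h, Measurable[𝒢'] fun ω => (E ω).action h
  reward_measurable : ∀ j h, Measurable[𝒢'] fun ω => (E ω).reward j h
  init_state : ∀ᵐ ω ∂μ, (E ω).state 0 = M.init
  action_law : ∀ (h : Fin H) (a : A),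
    μ[fun ω => if (E ω).action h = a then (1 : ℝ) else 0 | preAction 𝒢 E h]
      =ᵐ[μ] fun ω => (π ω).1 h ((E ω).state h.castSucc) a
  state_law : ∀ (h : Fin H) (s' : S),
    μ[fun ω => if (E ω).state h.succ = s' then (1 : ℝ) else 0 | postAction 𝒢 E h]
      =ᵐ[μ] fun ω => M.trans h ((E ω).state h.castSucc) ((E ω).action h) s'
  reward_range : ∀ (j : J) (h : Fin H), ∀ᵐ ω ∂μ, (E ω).reward j h ∈ Set.Icc (0 : ℝ) 1
  reward_mean : ∀ (j : J) (h : Fin H),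
    μ[fun ω => (E ω).reward j h | postAction 𝒢 E h]
      =ᵐ[μ] fun ω => M.reward (obs j) h ((E ω).state h.castSucc) ((E ω).action h)

end Sampling

section Algorithm

variable {S A J : Type*} [Fintype S] [DecidableEq S] [Fintype A] [DecidableEq A] {H : ℕ}

/-- `N_h^t(s,a)`: the number of visits of `(s,a)` at step `h` in the episodes `1, …, t`. -/
def visits (D : ℕ → Episode S A J H) (t : ℕ) (h : Fin H) (s : S) (a : A) : ℕ :=
  ((Finset.Icc 1 t).filter fun τ => (D τ).state h.castSucc = s ∧ (D τ).action h = a).card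

/-- `N_h^t(s,a,s')`. -/
def visitsNext (D : ℕ → Episode S A J H) (t : ℕ) (h : Fin H) (s : S) (a : A) (s' : S) : ℕ :=
  ((Finset.Icc 1 t).filter fun τ =>
    (D τ).state h.castSucc = s ∧ (D τ).action h = a ∧ (D τ).state h.succ = s').card

/-- The reward estimate from the episodes `1, …, t`. -/
noncomputable def rewardEst (D : ℕ → Episode S A J H) (j : J) (t : ℕ) (h : Fin H)
    (s : S) (a : A) : ℝ :=
  (∑ τ ∈ Finset.Icc 1 t,
      if (D τ).state h.castSucc = s ∧ (D τ).action h = a then (D τ).reward j h else 0)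
    / max (visits D t h s a : ℝ) 1

/-- The transition estimate from the episodes `1, …, t`. -/
noncomputable def transEst (D : ℕ → Episode S A J H) (t : ℕ) (h : Fin H)
    (s : S) (a : A) (s' : S) : ℝ :=
  (visitsNext D t h s a s' : ℝ) / max (visits D t h s a : ℝ) 1

/-- The logarithmic factor `log (8 m |S| |A| H T / δ)` of the bonuses. -/
noncomputable def bonusLog (S A : Type*) [Fintype S] [Fintype A] (H m T : ℕ) (δ : ℝ) : ℝ :=
  Real.log (8 * m * Fintype.card S * Fintype.card A * H * T / δ)

/-- The reward bonus. -/
noncomputable def rewardBonus (m T : ℕ) (δ : ℝ) (D : ℕ → Episode S A J H) (t : ℕ) (h : Fin H)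
    (s : S) (a : A) : ℝ :=
  min (Real.sqrt (2 * bonusLog S A H m T δ / max (visits D t h s a : ℝ) 1)) 1

/-- The transition bonus. -/
noncomputable def transBonus (m T : ℕ) (δ : ℝ) (D : ℕ → Episode S A J H) (t : ℕ) (h : Fin H)
    (s : S) (a : A) : ℝ :=
  min (Real.sqrt (2 * (H : ℝ) ^ 2 * Fintype.card S * bonusLog S A H m T δ /
    max (visits D t h s a : ℝ) 1)) H

/-- The optimistic Q-function at step `h`, built from the episodes `1, …, t` of the data set `D`
and from the next-step value function `Vnext`, clipped to `[0, H - h]` (with the first step being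
`h = 0`). -/
noncomputable def optQ (m T : ℕ) (δ : ℝ) (D : ℕ → Episode S A J H) (j : J) (t : ℕ) (h : Fin H)
    (Vnext : S → ℝ) (s : S) (a : A) : ℝ :=
  max (min (rewardEst D j t h s a + ∑ s', transEst D t h s a s' * Vnext s'
      + transBonus m T δ D t h s a + rewardBonus m T δ D t h s a) ((H : ℝ) - (h : ℕ))) 0

/-- The mirror-ascent step size `η = √(log m / (H² T))`. -/
noncomputable def stepSize (m H T : ℕ) : ℝ :=
  Real.sqrt (Real.log m / ((H : ℝ) ^ 2 * T))

/-- `p` maximizes the linear function `q` over the probability distributions on `A`. -/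
def IsGreedy (q : A → ℝ) (p : A → ℝ) : Prop :=
  IsMaxOn (fun p' : A → ℝ => ∑ a, q a * p' a) (stdSimplex ℝ A) p

end Algorithm

/-- A run of `T` rounds of TchRL in the environment `M` on the probability space `(Ω, μ)`, with
preference `lam`, regularizer `ι` and confidence parameter `δ`. Index `0` holds the initialization,
and the rounds are `1, …, T`. Ties in the greedy steps may be broken in any way that does not
anticipate the future. -/
structure TchRLRun {S A Ω : Type*} [Fintype S] [DecidableEq S] [MeasurableSpace S]
    [Fintype A] [DecidableEq A] [MeasurableSpace A] {H m : ℕ} [mΩ : MeasurableSpace Ω]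
    (M : MOMDP S A H m) (lam : Fin m → ℝ) (ι δ : ℝ) (T : ℕ) (μ : Measure Ω) where
  /-- `hist t` is the information available after round `t`. -/
  hist : Filtration ℕ mΩ
  /-- the weights `w^t` -/
  w : ℕ → Ω → Fin m → ℝ
  /-- the auxiliary optimistic Q-functions -/
  auxQ : ℕ → Ω → Fin m → Fin H → S → A → ℝ
  /-- the auxiliary value functions, with the terminal one at the last index -/
  auxV : ℕ → Ω → Fin m → Fin (H + 1) → S → ℝ
  /-- the optimistic Q-functions of the main policy -/
  mainQ : ℕ → Ω → Fin m → Fin H → S → A → ℝ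
  /-- the value functions of the main policy, with the terminal one at the last index -/
  mainV : ℕ → Ω → Fin m → Fin (H + 1) → S → ℝ
  /-- the auxiliary policies -/
  auxPol : ℕ → Fin m → Ω → Policy S A H
  /-- the main policies `π^t` -/
  mainPol : ℕ → Ω → Policy S A H
  /-- the episode sampled for objective `i` in each round: only reward `i` is observed -/
  auxEp : ℕ → Fin m → Ω → Episode S A Unit H
  /-- the episode sampled by the main policy in each round: all rewards are observed -/
  mainEp : ℕ → Ω → Episode S A (Fin m) H
  w_zero : ∀ ω i, w 0 ω i = 1 / (m : ℝ)
  auxV_zero : ∀ ω i h s, auxV 0 ω i h s = 0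
  mainV_zero : ∀ ω i h s, mainV 0 ω i h s = 0
  w_succ : ∀ t < T, ∀ ω i, w (t + 1) ω i =
    w t ω i * Real.exp (stepSize m H T *
        (lam i * (auxV t ω i 0 M.init + ι - mainV t ω i 0 M.init))) /
      ∑ j, w t ω j * Real.exp (stepSize m H T *
        (lam j * (auxV t ω j 0 M.init + ι - mainV t ω j 0 M.init)))
  auxV_last : ∀ t < T, ∀ ω i s, auxV (t + 1) ω i (Fin.last H) s = 0
  auxV_step : ∀ t < T, ∀ ω i (h : Fin H) s, auxV (t + 1) ω i h.castSucc s =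
    ∑ a, auxQ (t + 1) ω i h s a * (auxPol (t + 1) i ω).1 h s a
  auxQ_step : ∀ t < T, ∀ ω i (h : Fin H) s a, auxQ (t + 1) ω i h s a =
    optQ m T δ (fun τ => auxEp τ i ω) () t h (auxV (t + 1) ω i h.succ) s a
  auxPol_greedy : ∀ t < T, ∀ ω i h s,
    IsGreedy (auxQ (t + 1) ω i h s) ((auxPol (t + 1) i ω).1 h s)
  mainV_last : ∀ t < T, ∀ ω i s, mainV (t + 1) ω i (Fin.last H) s = 0
  mainV_step : ∀ t < T, ∀ ω i (h : Fin H) s, mainV (t + 1) ω i h.castSucc s =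
    ∑ a, mainQ (t + 1) ω i h s a * (mainPol (t + 1) ω).1 h s a
  mainQ_step : ∀ t < T, ∀ ω i (h : Fin H) s a, mainQ (t + 1) ω i h s a =
    optQ m T δ (fun τ => mainEp τ ω) i t h (mainV (t + 1) ω i h.succ) s a
  mainPol_greedy : ∀ t < T, ∀ ω h s,
    IsGreedy (fun a => ∑ i, w (t + 1) ω i * lam i * mainQ (t + 1) ω i h s a)
      ((mainPol (t + 1) ω).1 h s)
  auxEp_sampled : ∀ t < T, ∀ i, IsSampled M (fun _ : Unit => i) μ (hist t) (hist (t + 1))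
    (auxPol (t + 1) i) (auxEp (t + 1) i)
  mainEp_sampled : ∀ t < T, IsSampled M (fun i : Fin m => i) μ (hist t) (hist (t + 1))
    (mainPol (t + 1)) (mainEp (t + 1))

/-- The number of episodes sampled in `T` rounds: in every round one for each of the `m` objectives
and one for the main policy. -/
def numEpisodes (m T : ℕ) : ℕ := T * (m + 1)

/-!
The scalarization gap of the mixture is bounded on a confidence event of probability `1 - δ`, on
which the estimates built from each of the `m + 1` streams of episodes are accurate up to the
bonuses (`IsAccurate`).

Write `Ṽ`, `V` for the auxiliary and the main value functions and `g i = λ i * (Ṽ i + ι - V i)` for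
the gains of the weights. For every objective `i`,
`λ i * (V* i + ι - V^π i) ≤ g i + λ i * (V i - V^π i)` by optimism of the auxiliary values. Summed
over the rounds, `g i` is at most `∑ j, w j * g j` plus the regret of exponential weights
(`stepSize_regret`), and for every comparator `ρ`
`∑ j, w j * g j ≤ TCH(ρ) + ∑ j, λ j * (Ṽ j - V^ν j)`, where `ν` are the auxiliary policies. The last
step needs `∑ j, w j * λ j * V^ρ j ≤ ∑ j, w j * λ j * V j`: the main policy is optimistic for the
weighted sum of the objectives only, which suffices, and which follows by backward induction since
the transition estimates are accurate uniformly over value functions (`IsPlan.sum_value_le`).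

What remains are the sums over the rounds of `V i - V^π i` and `Ṽ j - V^ν j`. Each is at most twice
the expected sum of bonuses under the executed policy (`IsPlan.value_sub_le`); this differs from the
sum along the sampled episodes by a martingale, and the latter is
`O(H² |S| √(|A| T L))` by counting visits (`sum_bonus_le`).

All the probability is in one exponential supermartingale, for increments that count only when a
given state-action pair is visited (`integral_exp_visit_sum_le_one`). It yields Hoeffding bounds for
a fixed round and a fixed number of visits, and the logarithm `L` leaves room for a union bound over
both, over the pairs, the objectives and all subsets of the state space
(`measureReal_not_isReliable_le`); the subsets give the uniform accuracy in the `ℓ¹` form. The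
martingale property of whole episodes telescopes from the one-step conditional laws
(`IsSampled.condMean_total`), and Bellman recursion identifies it with the values defined through
trajectory laws (`value_eq_polEval`).
-/

/-! ### Hoeffding's lemma and exponential weights -/

/-- Hoeffding's lemma for a Bernoulli variable. -/
theorem one_sub_add_mul_exp_le {p : ℝ} (hp0 : 0 ≤ p) (hp1 : p ≤ 1) (x : ℝ) :
    1 - p + p * Real.exp x ≤ Real.exp (p * x + x ^ 2 / 8) := by
  let ν : Measure ℝ :=
    ENNReal.ofReal (1 - p) • Measure.dirac 0 + ENNReal.ofReal p • Measure.dirac 1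
  have hν : IsProbabilityMeasure ν := by
    constructor
    simp only [ν, Measure.coe_add, Measure.coe_smul, Pi.add_apply, Pi.smul_apply, measure_univ,
      smul_eq_mul, mul_one]
    rw [← ENNReal.ofReal_add (by linarith) hp0]
    simp
  have hint : ∀ f : ℝ → ℝ, ∫ y, f y ∂ν = (1 - p) * f 0 + p * f 1 := by
    intro f
    have hi : ∀ a c : ℝ, Integrable f (ENNReal.ofReal c • Measure.dirac a) := fun a c =>
      (integrable_dirac (by simp)).smul_measure ENNReal.ofReal_ne_top
    simp only [ν]
    rw [integral_add_measure (hi _ _) (hi _ _), integral_smul_measure, integral_smul_measure,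
      integral_dirac, integral_dirac, ENNReal.toReal_ofReal (by linarith),
      ENNReal.toReal_ofReal hp0]
    simp
  have hmem : ∀ᵐ y ∂ν, (fun y : ℝ => y) y ∈ Set.Icc (0 : ℝ) 1 := by
    simp only [ν]
    rw [ae_add_measure_iff]
    constructor <;> refine Measure.ae_smul_measure ?_ _ <;> rw [ae_dirac_eq] <;> simp
  have h := (hasSubgaussianMGF_of_mem_Icc (μ := ν) (X := fun y : ℝ => y)
    measurable_id.aemeasurable hmem).mgf_le x
  simp only [mgf, hint] at h
  have h2 := mul_le_mul_of_nonneg_left h (Real.exp_pos (p * x)).le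
  have e1 : Real.exp (p * x) * ((1 - p) * Real.exp (x * (0 - ((1 - p) * 0 + p * 1)))
      + p * Real.exp (x * (1 - ((1 - p) * 0 + p * 1)))) = 1 - p + p * Real.exp x := by
    have a1 : Real.exp (p * x) * Real.exp (x * (0 - ((1 - p) * 0 + p * 1))) = 1 := by
      rw [← Real.exp_add]; simp; ring
    have a2 : Real.exp (p * x) * Real.exp (x * (1 - ((1 - p) * 0 + p * 1))) = Real.exp x := by
      rw [← Real.exp_add]; congr 1; ring
    linear_combination (1 - p) * a1 + p * a2
  rw [e1, ← Real.exp_add] at h2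
  refine h2.trans (le_of_eq ?_)
  congr 1
  simp
  ring

theorem exp_mul_le_of_mem_Icc {y : ℝ} (h0 : 0 ≤ y) (h1 : y ≤ 1) (x : ℝ) :
    Real.exp (x * y) ≤ 1 - y + y * Real.exp x := by
  have := convexOn_exp.2 (Set.mem_univ 0) (Set.mem_univ x) (by linarith : 0 ≤ 1 - y) h0 (by ring)
  simpa [mul_comm] using this

/-- Hoeffding's lemma for a finite distribution `w` and a function `g` of range `R`. -/
theorem sum_mul_exp_le {ι : Type*} [Fintype ι] {w : ι → ℝ} (hw : w ∈ stdSimplex ℝ ι)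
    {g : ι → ℝ} {a R : ℝ} (hR : 0 < R) (hg : ∀ i, g i ∈ Set.Icc a (a + R)) (η : ℝ) :
    ∑ i, w i * Real.exp (η * g i) ≤ Real.exp (η * ∑ i, w i * g i + η ^ 2 * R ^ 2 / 8) := by
  set p := ∑ i, w i * ((g i - a) / R) with hp
  have hy : ∀ i, 0 ≤ (g i - a) / R ∧ (g i - a) / R ≤ 1 := fun i =>
    ⟨div_nonneg (by linarith [(hg i).1]) hR.le, by rw [div_le_one hR]; linarith [(hg i).2]⟩
  have hp0 : 0 ≤ p := Finset.sum_nonneg fun i _ => mul_nonneg (hw.1 i) (hy i).1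
  have hp1 : p ≤ 1 := by
    rw [← hw.2]
    exact Finset.sum_le_sum fun i _ => mul_le_of_le_one_right (hw.1 i) (hy i).2
  have hpm : ∑ i, w i * g i = a + R * p := by
    have e : ∀ i, w i * g i = w i * a + R * (w i * ((g i - a) / R)) := by
      intro i
      field_simp
      ring
    rw [Finset.sum_congr rfl fun i _ => e i, Finset.sum_add_distrib, ← Finset.sum_mul, hw.2,
      one_mul, ← Finset.mul_sum]
  have h1 : ∑ i, w i * Real.exp (η * g i)
      ≤ ∑ i, w i * (Real.exp (η * a) * (1 - (g i - a) / R
        + (g i - a) / R * Real.exp (η * R))) := by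
    refine Finset.sum_le_sum fun i _ => mul_le_mul_of_nonneg_left ?_ (hw.1 i)
    have : η * g i = η * a + (η * R) * ((g i - a) / R) := by field_simp; ring
    rw [this, Real.exp_add]
    exact mul_le_mul_of_nonneg_left (exp_mul_le_of_mem_Icc (hy i).1 (hy i).2 _)
      (Real.exp_pos _).le
  have h2 : ∑ i, w i * (Real.exp (η * a) * (1 - (g i - a) / R
        + (g i - a) / R * Real.exp (η * R)))
      = Real.exp (η * a) * (1 - p + p * Real.exp (η * R)) := by
    have e : ∀ i, w i * (Real.exp (η * a) * (1 - (g i - a) / R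
        + (g i - a) / R * Real.exp (η * R))) = Real.exp (η * a) * w i +
        Real.exp (η * a) * (Real.exp (η * R) - 1) * (w i * ((g i - a) / R)) := by
      intro i; ring
    simp only [e]
    rw [Finset.sum_add_distrib, ← Finset.mul_sum, ← Finset.mul_sum, hw.2, ← hp]
    ring
  calc _ ≤ _ := h1
    _ = _ := h2
    _ ≤ Real.exp (η * a) * Real.exp (p * (η * R) + (η * R) ^ 2 / 8) :=
      mul_le_mul_of_nonneg_left (one_sub_add_mul_exp_le hp0 hp1 _) (Real.exp_pos _).le
    _ = _ := by
      rw [← Real.exp_add, hpm]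
      congr 1
      ring

/-- The exponential-weights recursion keeps the weights in the simplex. -/
theorem expWeights_mem_stdSimplex {ι : Type*} [Fintype ι] [Nonempty ι] {T : ℕ}
    {w g : ℕ → ι → ℝ} {η : ℝ} (h0 : ∀ i, w 0 i = 1 / (Fintype.card ι : ℝ))
    (hs : ∀ t < T, ∀ i, w (t + 1) i =
      w t i * Real.exp (η * g t i) / ∑ j, w t j * Real.exp (η * g t j)) :
    ∀ t ≤ T, (∀ i, 0 < w t i) ∧ ∑ i, w t i = 1 := by
  intro t
  induction t with
  | zero =>
    intro _
    refine ⟨fun i => by rw [h0]; positivity, ?_⟩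
    simp [h0]
  | succ t ih =>
    intro ht
    obtain ⟨hpos, _⟩ := ih (by omega)
    have hZ : 0 < ∑ j, w t j * Real.exp (η * g t j) :=
      Finset.sum_pos (fun j _ => mul_pos (hpos j) (Real.exp_pos _)) Finset.univ_nonempty
    refine ⟨fun i => ?_, ?_⟩
    · rw [hs t (by omega)]
      exact div_pos (mul_pos (hpos i) (Real.exp_pos _)) hZ
    · simp only [hs t (by omega)]
      rw [← Finset.sum_div, div_self hZ.ne']

/-- The regret bound of exponential weights, multiplied by the step size `η`, so that it also
makes sense for `η = 0`. -/
theorem expWeights_regret {ι : Type*} [Fintype ι] [Nonempty ι] {T : ℕ}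
    {w g : ℕ → ι → ℝ} {η a R : ℝ} (hR : 0 < R)
    (hg : ∀ t < T, ∀ i, g t i ∈ Set.Icc a (a + R))
    (h0 : ∀ i, w 0 i = 1 / (Fintype.card ι : ℝ))
    (hs : ∀ t < T, ∀ i, w (t + 1) i =
      w t i * Real.exp (η * g t i) / ∑ j, w t j * Real.exp (η * g t j)) (i : ι) :
    η * ∑ t ∈ Finset.range T, (g t i - ∑ j, w t j * g t j) ≤
      Real.log (Fintype.card ι) + T * (η ^ 2 * R ^ 2 / 8) := by
  have hmem := expWeights_mem_stdSimplex h0 hs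
  have key : ∀ t ≤ T, η * ∑ τ ∈ Finset.range t, (g τ i - ∑ j, w τ j * g τ j)
      - t * (η ^ 2 * R ^ 2 / 8) ≤ Real.log (w t i) + Real.log (Fintype.card ι) := by
    intro t
    induction t with
    | zero => intro _; simp [h0]
    | succ t ih =>
      intro ht
      obtain ⟨hpos, hsum⟩ := hmem t (by omega)
      have ih := ih (by omega)
      have hZ : 0 < ∑ j, w t j * Real.exp (η * g t j) :=
        Finset.sum_pos (fun j _ => mul_pos (hpos j) (Real.exp_pos _)) Finset.univ_nonempty
      have hlogZ : Real.log (∑ j, w t j * Real.exp (η * g t j))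
          ≤ η * ∑ j, w t j * g t j + η ^ 2 * R ^ 2 / 8 := by
        rw [Real.log_le_iff_le_exp hZ]
        exact sum_mul_exp_le ⟨fun j => (hpos j).le, hsum⟩ hR (hg t (by omega)) η
      rw [hs t (by omega), Real.log_div (mul_pos (hpos i) (Real.exp_pos _)).ne' hZ.ne',
        Real.log_mul (hpos i).ne' (Real.exp_pos _).ne', Real.log_exp, Finset.sum_range_succ]
      push_cast
      linarith
  have h1 : Real.log (w T i) ≤ 0 := by
    obtain ⟨hpos, hsum⟩ := hmem T le_rfl
    refine Real.log_nonpos (hpos i).le ?_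
    rw [← hsum]
    exact Finset.single_le_sum (fun j _ => (hpos j).le) (Finset.mem_univ i)
  linarith [key T le_rfl]

/-! ### Policy evaluation and the minimizer of the scalarization -/

theorem policy_nonempty {S A : Type*} [Fintype A] [Nonempty A] {H : ℕ} :
    Nonempty (Policy S A H) := by
  classical
  obtain ⟨a⟩ := ‹Nonempty A›
  exact ⟨⟨fun _ _ => Pi.single a 1, fun _ _ => single_mem_stdSimplex ℝ a⟩⟩

theorem isCompact_policies {S A : Type*} [Fintype A] {H : ℕ} :
    IsCompact {π : Fin H → S → A → ℝ | ∀ h s, π h s ∈ stdSimplex ℝ A} := by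
  have : {π : Fin H → S → A → ℝ | ∀ h s, π h s ∈ stdSimplex ℝ A} =
      Set.pi Set.univ fun _ => Set.pi Set.univ fun _ => stdSimplex ℝ A := by
    ext π; simp [Set.mem_pi]
  rw [this]
  exact isCompact_univ_pi fun _ => isCompact_univ_pi fun _ => isCompact_stdSimplex ℝ A

section Evaluation

variable {S A : Type*} [Fintype S] [Fintype A]

/-- The expected sum of the step rewards `f` from a given step onwards, computed backwards by the
Bellman recursion. The index `Fin.last H` stands for the end of the episode. -/
noncomputable def polEval {H m : ℕ} (M : MOMDP S A H m) (π : Policy S A H)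
    (f : Fin H → S → A → ℝ) : Fin (H + 1) → S → ℝ :=
  Fin.reverseInduction (motive := fun _ => S → ℝ) (fun _ => 0)
    (fun h W s => ∑ a, π.1 h s a * (f h s a + ∑ s', M.trans h s a s' * W s'))

variable {H m : ℕ} (M : MOMDP S A H m) (π : Policy S A H)

theorem polEval_last (f : Fin H → S → A → ℝ) (s : S) : polEval M π f (Fin.last H) s = 0 := by
  simp [polEval]

theorem polEval_castSucc (f : Fin H → S → A → ℝ) (h : Fin H) (s : S) :
    polEval M π f h.castSucc s =
      ∑ a, π.1 h s a * (f h s a + ∑ s', M.trans h s a s' * polEval M π f h.succ s') := by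
  simp [polEval]

theorem polEval_mem_Icc {f : Fin H → S → A → ℝ} {c : ℝ}
    (hf : ∀ h s a, f h s a ∈ Set.Icc 0 c) (h : Fin (H + 1)) (s : S) :
    polEval M π f h s ∈ Set.Icc 0 (c * ((H : ℝ) - (h : ℕ))) := by
  induction h using Fin.reverseInduction generalizing s with
  | last => simp [polEval_last]
  | cast h ih =>
    have ht := fun a => M.trans_mem h s a
    have hp := π.2 h s
    have hP : ∀ a, ∑ s', M.trans h s a s' * polEval M π f h.succ s' ∈
        Set.Icc 0 (c * ((H : ℝ) - ((h : ℕ) + 1))) := by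
      intro a
      refine ⟨Finset.sum_nonneg fun s' _ => mul_nonneg ((ht a).1 s') (ih s').1, ?_⟩
      calc _ ≤ ∑ s', M.trans h s a s' * (c * ((H : ℝ) - ((h : ℕ) + 1))) := by
            refine Finset.sum_le_sum fun s' _ => mul_le_mul_of_nonneg_left ?_ ((ht a).1 s')
            simpa using (ih s').2
        _ = _ := by rw [← Finset.sum_mul, (ht a).2, one_mul]
    rw [polEval_castSucc]
    refine ⟨Finset.sum_nonneg fun a _ =>
      mul_nonneg (hp.1 a) (add_nonneg (hf h s a).1 (hP a).1), ?_⟩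
    calc _ ≤ ∑ a, π.1 h s a * (c * ((H : ℝ) - (h : ℕ))) := by
          refine Finset.sum_le_sum fun a _ => mul_le_mul_of_nonneg_left ?_ (hp.1 a)
          have := (hf h s a).2
          have := (hP a).2
          linarith
      _ = _ := by rw [← Finset.sum_mul, hp.2, one_mul]; simp

theorem polEval_const_mul (f : Fin H → S → A → ℝ) (c : ℝ) (h : Fin (H + 1)) (s : S) :
    polEval M π (fun h s a => c * f h s a) h s = c * polEval M π f h s := by
  induction h using Fin.reverseInduction generalizing s with
  | last => simp [polEval_last]
  | cast h ih =>
    rw [polEval_castSucc, polEval_castSucc, Finset.mul_sum]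
    refine Finset.sum_congr rfl fun a _ => ?_
    have : ∑ s', M.trans h s a s' * polEval M π (fun h s a => c * f h s a) h.succ s'
        = c * ∑ s', M.trans h s a s' * polEval M π f h.succ s' := by
      rw [Finset.mul_sum]
      exact Finset.sum_congr rfl fun s' _ => by rw [ih]; ring
    rw [this]
    ring

variable [DecidableEq S]

/-- A total of step rewards, weighted with a product of transition weights along the trajectory,
equals the solution of the corresponding backward recursion. -/
theorem sum_traj_eq_of_recursion : ∀ (H : ℕ) (p : Fin H → S → A → ℝ) (P : Fin H → S → A → S → ℝ)
    (f : Fin H → S → A → ℝ) (W : Fin (H + 1) → S → ℝ)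
    (_ : ∀ h s, ∑ a, p h s a = 1) (_ : ∀ h s a, ∑ s', P h s a s' = 1)
    (_ : ∀ s, W (Fin.last H) s = 0)
    (_ : ∀ (h : Fin H) s, W h.castSucc s =
      ∑ a, p h s a * (f h s a + ∑ s', P h s a s' * W h.succ s')) (s₀ : S),
    (∑ x : Traj S A H, (if x.1 0 = s₀ then 1 else 0) *
      ∏ h : Fin H, (p h (x.1 h.castSucc) (x.2 h) * P h (x.1 h.castSucc) (x.2 h) (x.1 h.succ)) = 1) ∧
    (∑ x : Traj S A H, ((if x.1 0 = s₀ then 1 else 0) *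
      ∏ h : Fin H, (p h (x.1 h.castSucc) (x.2 h) * P h (x.1 h.castSucc) (x.2 h) (x.1 h.succ))) *
        ∑ h : Fin H, f h (x.1 h.castSucc) (x.2 h) = W 0 s₀) := by
  intro H
  induction H with
  | zero =>
    intro p P f W _ _ hl _ s₀
    have := hl s₀
    simp only [Fin.last_zero] at this
    simp only [Finset.univ_eq_empty, Finset.prod_empty, mul_one, Finset.sum_empty, mul_zero,
      Finset.sum_const_zero, this, and_true]
    rw [Fintype.sum_prod_type]
    simp only [Fintype.sum_unique]
    rw [Fintype.sum_equiv (Equiv.funUnique (Fin 1) S) _ (fun s => if s = s₀ then (1 : ℝ) else 0)]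
    · simp
    · intro x
      simp
  | succ H ih =>
    intro p P f W hp hP hl hW s₀
    have IH := ih (fun h => p h.succ) (fun h => P h.succ) (fun h => f h.succ) (fun h => W h.succ)
      (fun h => hp _) (fun h => hP _) (fun s => by simpa using hl s)
      (fun h s => by simpa using hW h.succ s)
    -- Split off the first state and the first action.
    have split : ∀ F : Traj S A (H + 1) → ℝ, ∑ x, F x =
        ∑ s, ∑ a, ∑ y : Traj S A H, F (Fin.cons s y.1, Fin.cons a y.2) := by
      intro F
      rw [Fintype.sum_prod_type]
      rw [← (Fin.consEquiv (fun _ : Fin (H + 2) => S)).sum_comp, Fintype.sum_prod_type]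
      refine Finset.sum_congr rfl fun s _ => ?_
      simp_rw [← (Fin.consEquiv (fun _ : Fin (H + 1) => A)).sum_comp, Fintype.sum_prod_type]
      rw [Finset.sum_comm]
      refine Finset.sum_congr rfl fun a _ => ?_
      rfl
    have e : ∀ (s : S) (a : A) (y : Traj S A H),
        (if (Fin.cons s y.1 : Fin (H + 2) → S) 0 = s₀ then (1 : ℝ) else 0) *
          ∏ h : Fin (H + 1), (p h ((Fin.cons s y.1 : Fin (H + 2) → S) h.castSucc)
            ((Fin.cons a y.2 : Fin (H + 1) → A) h) *
            P h ((Fin.cons s y.1 : Fin (H + 2) → S) h.castSucc)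
              ((Fin.cons a y.2 : Fin (H + 1) → A) h) ((Fin.cons s y.1 : Fin (H + 2) → S) h.succ))
        = (if s = s₀ then 1 else 0) * (p 0 s a * ∑ s', P 0 s a s' *
          ((if y.1 0 = s' then 1 else 0) * ∏ h : Fin H, (p h.succ (y.1 h.castSucc) (y.2 h) *
            P h.succ (y.1 h.castSucc) (y.2 h) (y.1 h.succ)))) := by
      intro s a y
      rw [Fin.prod_univ_succ]
      simp only [Fin.cons_zero, Fin.castSucc_zero, Fin.cons_succ, ← Fin.succ_castSucc]
      simp only [ite_mul, one_mul, zero_mul, mul_ite, mul_zero, Finset.sum_ite_eq,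
        Finset.mem_univ, if_true, mul_assoc]
    constructor
    · rw [split]
      simp only [e]
      have : ∀ s a, ∑ y : Traj S A H,
          (if s = s₀ then (1 : ℝ) else 0) * (p 0 s a * ∑ s', P 0 s a s' *
          ((if y.1 0 = s' then 1 else 0) * ∏ h : Fin H, (p h.succ (y.1 h.castSucc) (y.2 h) *
            P h.succ (y.1 h.castSucc) (y.2 h) (y.1 h.succ)))) =
          (if s = s₀ then 1 else 0) * p 0 s a := by
        intro s a
        rw [← Finset.mul_sum, ← Finset.mul_sum, Finset.sum_comm]
        simp only [← Finset.mul_sum]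
        simp only [(IH _).1, mul_one, hP]
      simp only [this, ← Finset.mul_sum, hp, mul_one]
      simp
    · rw [split]
      simp only [e]
      have : ∀ s a, ∑ y : Traj S A H,
          ((if s = s₀ then (1 : ℝ) else 0) * (p 0 s a * ∑ s', P 0 s a s' *
          ((if y.1 0 = s' then 1 else 0) * ∏ h : Fin H, (p h.succ (y.1 h.castSucc) (y.2 h) *
            P h.succ (y.1 h.castSucc) (y.2 h) (y.1 h.succ))))) *
            ∑ h : Fin (H + 1), f h ((Fin.cons s y.1 : Fin (H + 2) → S) h.castSucc)
            ((Fin.cons a y.2 : Fin (H + 1) → A) h) =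
          (if s = s₀ then 1 else 0) * (p 0 s a * (f 0 s a + ∑ s', P 0 s a s' * W 1 s')) := by
        intro s a
        simp only [Fin.sum_univ_succ, Fin.cons_zero, Fin.castSucc_zero, Fin.cons_succ,
          ← Fin.succ_castSucc]
        set L : Traj S A H → S → ℝ := fun y s' => (if y.1 0 = s' then 1 else 0) *
          ∏ h : Fin H, (p h.succ (y.1 h.castSucc) (y.2 h) *
            P h.succ (y.1 h.castSucc) (y.2 h) (y.1 h.succ)) with hL
        set R : Traj S A H → ℝ := fun y => ∑ h : Fin H, f h.succ (y.1 h.castSucc) (y.2 h) with hR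
        have h1 : ∀ s', ∑ y, L y s' = 1 := fun s' => (IH s').1
        have h2 : ∀ s', ∑ y, L y s' * R y = W 1 s' := fun s' => (IH s').2
        have e2 : ∀ y, (if s = s₀ then (1 : ℝ) else 0) * (p 0 s a * ∑ s', P 0 s a s' * L y s') *
            (f 0 s a + R y) = ∑ s', (if s = s₀ then (1 : ℝ) else 0) * (p 0 s a *
              (P 0 s a s' * (L y s' * f 0 s a + L y s' * R y))) := by
          intro y
          simp only [Finset.mul_sum, Finset.sum_mul]
          exact Finset.sum_congr rfl fun s' _ => by ring
        rw [Finset.sum_congr rfl fun y _ => e2 y, Finset.sum_comm]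
        simp only [← Finset.mul_sum, Finset.sum_add_distrib, ← Finset.sum_mul, h1, h2]
        congr 2
        simp only [one_mul, mul_add, Finset.sum_add_distrib, ← Finset.sum_mul, hP]
      simp only [this, ← Finset.mul_sum]
      have h0 := hW 0 s₀
      simp only [Fin.castSucc_zero, Fin.succ_zero_eq_one] at h0
      simp [h0]

theorem value_eq_polEval (i : Fin m) : value M i π = polEval M π (M.reward i) 0 M.init :=
  (sum_traj_eq_of_recursion H π.1 M.trans (M.reward i) (polEval M π (M.reward i))
    (fun h s => (π.2 h s).2) (fun h s a => (M.trans_mem h s a).2) (polEval_last M π _)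
    (polEval_castSucc M π _) M.init).2

theorem value_mem_Icc (i : Fin m) : value M i π ∈ Set.Icc (0 : ℝ) H := by
  rw [value_eq_polEval]
  simpa using polEval_mem_Icc M π (M.reward_mem i) 0 M.init

theorem value_le_optValue (i : Fin m) : value M i π ≤ optValue M i :=
  le_ciSup (f := fun π => value M i π)
    ⟨H, by rintro _ ⟨π, rfl⟩; exact (value_mem_Icc M π i).2⟩ π

theorem expReturn_mixLaw (i : Fin m) (T : ℕ) (π : ℕ → Policy S A H) :
    expReturn M i (mixLaw M T π) = (1 / (T : ℝ)) * ∑ t ∈ Finset.Icc 1 T, value M i (π t) := by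
  simp only [expReturn, mixLaw, value, Finset.sum_mul]
  rw [Finset.sum_comm, Finset.mul_sum]
  refine Finset.sum_congr rfl fun t _ => ?_
  rw [Finset.mul_sum]
  exact Finset.sum_congr rfl fun x _ => by ring

/-- With a single action there is only one policy, so that the mixture has no regret. -/
theorem tchMix_eq_tch_of_card_eq_one {lam : Fin m → ℝ} {ι : ℝ} {T : ℕ}
    (hA : Fintype.card A = 1) (hT : 1 ≤ T)
    (π : ℕ → Policy S A H) (ρ : Policy S A H) : tchMix M lam ι T π = tch M lam ι ρ := by
  obtain ⟨a₀, ha₀⟩ := Fintype.card_eq_one_iff.mp hA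
  have huniq : ∀ π : Policy S A H, π = ρ := by
    intro π
    have h1 : ∀ (π : Policy S A H) h s a, π.1 h s a = 1 := by
      intro π h s a
      rw [← (π.2 h s).2]
      exact (Fintype.sum_eq_single a fun b hb => absurd ((ha₀ b).trans (ha₀ a).symm) hb).symm
    exact Subtype.ext (by funext h s a; rw [h1, h1])
  have hT0 : (T : ℝ) ≠ 0 := by positivity
  unfold tchMix tch tchLaw
  congr 1
  funext i
  rw [expReturn_mixLaw, Finset.sum_congr rfl fun t _ => by rw [huniq (π t)], Finset.sum_const,
    Nat.card_Icc, nsmul_eq_mul, Nat.add_sub_cancel, ← mul_assoc, one_div, inv_mul_cancel₀ hT0,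
    one_mul]
  rfl

theorem le_tch (lam : Fin m → ℝ) (ι : ℝ) (i : Fin m) :
    lam i * (optValue M i + ι - value M i π) ≤ tch M lam ι π :=
  le_ciSup (f := fun i => lam i * (optValue M i + ι - value M i π)) (Set.finite_range _).bddAbove i

theorem continuous_value (i : Fin m) : Continuous fun π : Policy S A H => value M i π := by
  unfold value expReturn trajLaw
  have h : ∀ (h : Fin H) (s : S) (a : A), Continuous fun π : Policy S A H => π.1 h s a :=
    fun h s a => by
      exact (continuous_apply a).comp ((continuous_apply s).comp
        ((continuous_apply h).comp continuous_subtype_val))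
  exact continuous_finsetSum _ fun x _ => (continuous_const.mul (continuous_finsetProd _
    fun k _ => (h _ _ _).mul continuous_const)).mul continuous_const

theorem exists_isMinOn_tch [Nonempty A] (hm : 0 < m) (lam : Fin m → ℝ) (ι : ℝ) :
    ∃ π : Policy S A H, IsMinOn (tch M lam ι) Set.univ π := by
  have : Nonempty (Fin m) := ⟨⟨0, hm⟩⟩
  have : Nonempty (Policy S A H) := policy_nonempty
  have : CompactSpace (Policy S A H) := isCompact_iff_compactSpace.mp isCompact_policies
  have hc : Continuous (tch M lam ι : Policy S A H → ℝ) := by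
    have : (tch M lam ι : Policy S A H → ℝ) = fun π => Finset.univ.sup' Finset.univ_nonempty
        fun i => lam i * (optValue M i + ι - value M i π) := by
      funext π
      rw [Finset.sup'_univ_eq_ciSup]
      rfl
    rw [this]
    refine Continuous.finset_sup'_apply _ fun i _ => ?_
    have := continuous_value (A := A) M i
    fun_prop
  obtain ⟨π, -, h⟩ := isCompact_univ.exists_isMinOn Set.univ_nonempty hc.continuousOn
  exact ⟨π, h⟩

end Evaluation

/-! ### Exponential tail bounds for sums over random visits -/

section Concentration

variable {Ω : Type*} {mΩ : MeasurableSpace Ω} {μ : Measure Ω}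

/-- `W` has the same integrals as `Y` against all essentially bounded `m`-measurable test
functions. For integrable `Y` and `W`, with `W` measurable for `m`, this says `μ[Y | m] = W` almost
everywhere; the weak form avoids manipulating conditional expectations. -/
def CondMean (μ : Measure Ω) (m : MeasurableSpace Ω) (Y W : Ω → ℝ) : Prop :=
  ∀ k : Ω → ℝ, Measurable[m] k → (∃ C : ℝ, ∀ᵐ ω ∂μ, |k ω| ≤ C) →
    ∫ ω, k ω * Y ω ∂μ = ∫ ω, k ω * W ω ∂μ

theorem condMean_of_condExp {Ω : Type*} {m mΩ : MeasurableSpace Ω} {μ : Measure Ω}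
    [IsFiniteMeasure μ] (hm : m ≤ mΩ)
    {Y W : Ω → ℝ} (hY : Integrable Y μ) (h : μ[Y|m] =ᵐ[μ] W) : CondMean μ m Y W := by
  rintro k hk ⟨C, hC⟩
  have hint : Integrable (k * Y) μ :=
    hY.bdd_mul (hk.mono hm le_rfl).aestronglyMeasurable (by simpa using hC)
  have h1 := condExp_mul_of_stronglyMeasurable_left (μ := μ) (m := m) hk.stronglyMeasurable hint hY
  calc ∫ ω, k ω * Y ω ∂μ = ∫ ω, (μ[k * Y|m]) ω ∂μ := (integral_condExp hm).symm
    _ = ∫ ω, k ω * W ω ∂μ := by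
      refine integral_congr_ae ?_
      filter_upwards [h1, h] with ω h1 h2
      rw [h1, Pi.mul_apply, h2]

theorem integrable_of_abs_le [IsFiniteMeasure μ] {f : Ω → ℝ} (hf : Measurable f) (C : ℝ)
    (h : ∀ᵐ ω ∂μ, |f ω| ≤ C) : Integrable f μ :=
  Integrable.of_bound hf.aestronglyMeasurable C (by simpa using h)

/-- The exponential supermartingale of a sum of centred increments `Y - W`, with `Y` in `[0,1]`,
over the rounds in which the indicator `B` equals one. The information `m t` refines the history
`ℱ t`: it already contains the indicator `B t`, but not yet the observation `Y t`. -/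
theorem integral_exp_visit_sum_le_one [IsProbabilityMeasure μ] (ℱ : Filtration ℕ mΩ) {T : ℕ}
    {m : ℕ → MeasurableSpace Ω} {B Y W : ℕ → Ω → ℝ}
    (hm : ∀ t < T, ℱ t ≤ m t) (hm' : ∀ t < T, m t ≤ ℱ (t + 1))
    (hB : ∀ t < T, Measurable[m t] (B t)) (hW : ∀ t < T, Measurable[m t] (W t))
    (hY : ∀ t < T, Measurable[ℱ (t + 1)] (Y t))
    (hB01 : ∀ t < T, ∀ ω, B t ω = 0 ∨ B t ω = 1)
    (hW01 : ∀ t < T, ∀ ω, W t ω ∈ Set.Icc (0 : ℝ) 1)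
    (hY01 : ∀ t < T, ∀ᵐ ω ∂μ, Y t ω ∈ Set.Icc (0 : ℝ) 1)
    (hYW : ∀ t < T, CondMean μ (m t) (Y t) (W t)) (θ : ℝ) :
    ∀ t ≤ T, Measurable[ℱ t] (fun ω => Real.exp (∑ τ ∈ Finset.range t,
        (θ * (B τ ω * (Y τ ω - W τ ω)) - θ ^ 2 / 8 * B τ ω))) ∧
      (∃ C : ℝ, ∀ᵐ ω ∂μ, |Real.exp (∑ τ ∈ Finset.range t,
        (θ * (B τ ω * (Y τ ω - W τ ω)) - θ ^ 2 / 8 * B τ ω))| ≤ C) ∧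
      ∫ ω, Real.exp (∑ τ ∈ Finset.range t,
        (θ * (B τ ω * (Y τ ω - W τ ω)) - θ ^ 2 / 8 * B τ ω)) ∂μ ≤ 1 := by
  intro t
  induction t with
  | zero => intro _; exact ⟨by simp, ⟨1, by simp⟩, by simp⟩
  | succ t ih =>
    intro ht
    have ht' : t < T := by omega
    obtain ⟨hGm, ⟨C, hC⟩, hG1⟩ := ih (by omega)
    set G : Ω → ℝ := fun ω => Real.exp (∑ τ ∈ Finset.range t,
        (θ * (B τ ω * (Y τ ω - W τ ω)) - θ ^ 2 / 8 * B τ ω)) with hGdef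
    set I : Ω → ℝ := fun ω =>
      Real.exp (θ * (B t ω * (Y t ω - W t ω)) - θ ^ 2 / 8 * B t ω) with hIdef
    have hGpos : ∀ ω, 0 < G ω := fun ω => Real.exp_pos _
    have hsucc : (fun ω => Real.exp (∑ τ ∈ Finset.range (t + 1),
        (θ * (B τ ω * (Y τ ω - W τ ω)) - θ ^ 2 / 8 * B τ ω))) = fun ω => G ω * I ω := by
      funext ω
      rw [Finset.sum_range_succ, Real.exp_add]
    rw [show (∫ ω, Real.exp (∑ τ ∈ Finset.range (t + 1),
        (θ * (B τ ω * (Y τ ω - W τ ω)) - θ ^ 2 / 8 * B τ ω)) ∂μ) = ∫ ω, G ω * I ω ∂μ by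
          rw [← hsucc],
      hsucc]
    have hsucc' : ∀ ω, Real.exp (∑ τ ∈ Finset.range (t + 1),
        (θ * (B τ ω * (Y τ ω - W τ ω)) - θ ^ 2 / 8 * B τ ω)) = G ω * I ω := congrFun hsucc
    simp only [hsucc']
    have hmem : ∀ᵐ ω ∂μ, |I ω| ≤ Real.exp |θ| := by
      filter_upwards [hY01 t ht'] with ω hy
      rw [abs_of_pos (Real.exp_pos _), Real.exp_le_exp]
      have hw := hW01 t ht' ω
      have h1 : |Y t ω - W t ω| ≤ 1 := by
        rw [abs_le]; constructor <;> linarith [hy.1, hy.2, hw.1, hw.2]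
      have h2 : θ * (Y t ω - W t ω) ≤ |θ| := by
        calc θ * (Y t ω - W t ω) ≤ |θ * (Y t ω - W t ω)| := le_abs_self _
          _ = |θ| * |Y t ω - W t ω| := abs_mul _ _
          _ ≤ |θ| := mul_le_of_le_one_right (abs_nonneg _) h1
      rcases hB01 t ht' ω with h | h <;> rw [h]
      · simp
      · nlinarith [sq_nonneg θ]
    have hGm' : Measurable[m t] G := hGm.mono (hm t ht') le_rfl
    have hG' : Measurable[ℱ (t + 1)] G := hGm.mono (ℱ.mono (Nat.le_succ t)) le_rfl
    have hBF : Measurable[ℱ (t + 1)] (B t) := (hB t ht').mono (hm' t ht') le_rfl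
    have hWF : Measurable[ℱ (t + 1)] (W t) := (hW t ht').mono (hm' t ht') le_rfl
    have hYF := hY t ht'
    have hI : Measurable[ℱ (t + 1)] I :=
      Real.measurable_exp.comp (((hBF.mul (hYF.sub hWF)).const_mul θ).sub (hBF.const_mul _))
    have hGI : Measurable[ℱ (t + 1)] fun ω => G ω * I ω := hG'.mul hI
    have hGIb : ∀ᵐ ω ∂μ, |G ω * I ω| ≤ C * Real.exp |θ| := by
      filter_upwards [hC, hmem] with ω h1 h2
      rw [abs_mul]
      exact mul_le_mul h1 h2 (abs_nonneg _) ((abs_nonneg _).trans h1)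
    refine ⟨hGI, ⟨_, hGIb⟩, ?_⟩
    -- By convexity the increment lies below a function that is affine in `Y`, whose integral
    -- is not changed by replacing `Y` with `W`.
    set e : Ω → ℝ := fun ω => B t ω * Real.exp (-θ * W t ω - θ ^ 2 / 8) with hedef
    have he : Measurable[m t] e := (hB t ht').mul
      (Real.measurable_exp.comp (((hW t ht').const_mul (-θ)).sub_const _))
    have heb : ∀ ω, |e ω| ≤ Real.exp |θ| := by
      intro ω
      have hw := hW01 t ht' ω
      have h2 : -θ * W t ω ≤ |θ| := by
        calc -θ * W t ω ≤ |-θ * W t ω| := le_abs_self _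
          _ = |θ| * |W t ω| := by rw [abs_mul, abs_neg]
          _ ≤ |θ| := mul_le_of_le_one_right (abs_nonneg _) (by rw [abs_of_nonneg hw.1]; exact hw.2)
      simp only [hedef]
      rcases hB01 t ht' ω with h | h <;> rw [h]
      · simpa using (Real.exp_pos _).le
      · rw [one_mul, abs_of_pos (Real.exp_pos _), Real.exp_le_exp]
        nlinarith [sq_nonneg θ]
    set k0 : Ω → ℝ := fun ω => G ω * (1 - B t ω + e ω) with hk0
    set k1 : Ω → ℝ := fun ω => G ω * e ω * (Real.exp θ - 1) with hk1
    have hk0m : Measurable[m t] k0 := hGm'.mul ((measurable_const.sub (hB t ht')).add he)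
    have hk1m : Measurable[m t] k1 := (hGm'.mul he).mul_const _
    have hmΩ : m t ≤ mΩ := (hm' t ht').trans (ℱ.le _)
    have hk1b : ∀ᵐ ω ∂μ, |k1 ω| ≤ C * Real.exp |θ| * |Real.exp θ - 1| := by
      filter_upwards [hC] with ω h1
      simp only [hk1, abs_mul]
      exact mul_le_mul_of_nonneg_right (mul_le_mul h1 (heb ω) (abs_nonneg _)
        ((abs_nonneg _).trans h1)) (abs_nonneg _)
    have hk0b : ∀ᵐ ω ∂μ, |k0 ω| ≤ C * (1 + Real.exp |θ|) := by
      filter_upwards [hC] with ω h1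
      simp only [hk0, abs_mul]
      refine mul_le_mul h1 ?_ (abs_nonneg _) ((abs_nonneg _).trans h1)
      refine (abs_add_le _ _).trans (add_le_add ?_ (heb ω))
      rcases hB01 t ht' ω with h | h <;> rw [h] <;> simp
    have hk0i := integrable_of_abs_le (hk0m.mono hmΩ le_rfl) _ hk0b
    have hmulb : ∀ {Z : Ω → ℝ}, (∀ᵐ ω ∂μ, Z ω ∈ Set.Icc (0 : ℝ) 1) → Measurable Z →
        Integrable (fun ω => k1 ω * Z ω) μ := by
      intro Z hZ hZm
      refine integrable_of_abs_le ((hk1m.mono hmΩ le_rfl).mul hZm)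
        (C * Real.exp |θ| * |Real.exp θ - 1|) ?_
      filter_upwards [hZ, hk1b] with ω h1 h2
      rw [abs_mul, abs_of_nonneg h1.1]
      exact (mul_le_of_le_one_right (abs_nonneg _) h1.2).trans h2
    have hk1Y := hmulb (hY01 t ht') (hYF.mono (ℱ.le _) le_rfl)
    have hk1W := hmulb (ae_of_all _ (hW01 t ht')) (hWF.mono (ℱ.le _) le_rfl)
    calc ∫ ω, G ω * I ω ∂μ ≤ ∫ ω, (k0 ω + k1 ω * Y t ω) ∂μ := by
          refine integral_mono_ae (integrable_of_abs_le (hGI.mono (ℱ.le _) le_rfl) _ hGIb)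
            (hk0i.add hk1Y) ?_
          filter_upwards [hY01 t ht'] with ω hy
          have h3 : I ω ≤ 1 - B t ω + e ω + e ω * (Real.exp θ - 1) * Y t ω := by
            simp only [hIdef, hedef]
            rcases hB01 t ht' ω with h | h <;> rw [h]
            · simp
            · have e1 : θ * (1 * (Y t ω - W t ω)) - θ ^ 2 / 8 * 1 =
                  (-θ * W t ω - θ ^ 2 / 8) + θ * Y t ω := by ring
              rw [e1, Real.exp_add]
              have := mul_le_mul_of_nonneg_left (exp_mul_le_of_mem_Icc hy.1 hy.2 θ)
                (Real.exp_pos (-θ * W t ω - θ ^ 2 / 8)).le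
              linarith
          have := mul_le_mul_of_nonneg_left h3 (hGpos ω).le
          simp only [hk0, hk1]
          linarith
      _ = ∫ ω, (k0 ω + k1 ω * W t ω) ∂μ := by
          rw [integral_add hk0i hk1Y, integral_add hk0i hk1W, hYW t ht' k1 hk1m ⟨_, hk1b⟩]
      _ ≤ ∫ ω, G ω ∂μ := by
          refine integral_mono (hk0i.add hk1W)
            (integrable_of_abs_le (hGm.mono (ℱ.le _) le_rfl) _ hC) fun ω => ?_
          have hw := hW01 t ht' ω
          have h3 : 1 - B t ω + e ω + e ω * (Real.exp θ - 1) * W t ω ≤ 1 := by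
            simp only [hedef]
            rcases hB01 t ht' ω with h | h <;> rw [h]
            · simp
            · have := mul_le_mul_of_nonneg_left (one_sub_add_mul_exp_le hw.1 hw.2 θ)
                (Real.exp_pos (-θ * W t ω - θ ^ 2 / 8)).le
              rw [← Real.exp_add] at this
              have e1 : (-θ * W t ω - θ ^ 2 / 8) + (W t ω * θ + θ ^ 2 / 8) = 0 := by ring
              rw [e1, Real.exp_zero] at this
              linarith
          have := mul_le_mul_of_nonneg_left h3 (hGpos ω).le
          simp only [hk0, hk1]
          linarith
      _ ≤ 1 := hG1

/-- Hoeffding's inequality for a sum over random visits, on the event that the number of visits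
equals `n`. -/
theorem measureReal_visit_sum_ge_le [IsProbabilityMeasure μ] (ℱ : Filtration ℕ mΩ) {T : ℕ}
    {m : ℕ → MeasurableSpace Ω} {B Y W : ℕ → Ω → ℝ}
    (hm : ∀ t < T, ℱ t ≤ m t) (hm' : ∀ t < T, m t ≤ ℱ (t + 1))
    (hB : ∀ t < T, Measurable[m t] (B t)) (hW : ∀ t < T, Measurable[m t] (W t))
    (hY : ∀ t < T, Measurable[ℱ (t + 1)] (Y t))
    (hB01 : ∀ t < T, ∀ ω, B t ω = 0 ∨ B t ω = 1)
    (hW01 : ∀ t < T, ∀ ω, W t ω ∈ Set.Icc (0 : ℝ) 1)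
    (hY01 : ∀ t < T, ∀ᵐ ω ∂μ, Y t ω ∈ Set.Icc (0 : ℝ) 1)
    (hYW : ∀ t < T, CondMean μ (m t) (Y t) (W t)) {t n : ℕ} (ht : t ≤ T) (hn : 1 ≤ n)
    {x : ℝ} (hx : 0 ≤ x) {σ : ℝ} (hσ : σ ^ 2 = 1) :
    μ.real {ω | ∑ τ ∈ Finset.range t, B τ ω = n ∧
      x ≤ σ * ∑ τ ∈ Finset.range t, B τ ω * (Y τ ω - W τ ω)} ≤ Real.exp (-(2 * x ^ 2 / n)) := by
  have hn0 : (0 : ℝ) < n := by exact_mod_cast hn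
  set θ := σ * (4 * x / n) with hθ
  obtain ⟨hm1, ⟨C, hC⟩, h1⟩ := integral_exp_visit_sum_le_one ℱ hm hm' hB hW hY hB01 hW01 hY01 hYW
    θ t ht
  have hθ2 : θ ^ 2 = (4 * x / n) ^ 2 := by rw [hθ, mul_pow, hσ, one_mul]
  have hmk := mul_meas_ge_le_integral_of_nonneg (μ := μ)
    (ae_of_all _ fun ω => (Real.exp_pos _).le)
    (integrable_of_abs_le (hm1.mono (ℱ.le _) le_rfl) C hC) (Real.exp (2 * x ^ 2 / n))
  have hsub : {ω | ∑ τ ∈ Finset.range t, B τ ω = n ∧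
      x ≤ σ * ∑ τ ∈ Finset.range t, B τ ω * (Y τ ω - W τ ω)} ⊆
      {ω | Real.exp (2 * x ^ 2 / n) ≤ Real.exp (∑ τ ∈ Finset.range t,
        (θ * (B τ ω * (Y τ ω - W τ ω)) - θ ^ 2 / 8 * B τ ω))} := by
    rintro ω ⟨h1, h2⟩
    simp only [Set.mem_ofPred_eq, Real.exp_le_exp]
    rw [Finset.sum_sub_distrib, ← Finset.mul_sum, ← Finset.mul_sum, h1, hθ2]
    have h3 := mul_le_mul_of_nonneg_left h2 (by positivity : 0 ≤ 4 * x / n)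
    have e1 : 2 * x ^ 2 / n = 4 * x / n * x - (4 * x / n) ^ 2 / 8 * n := by
      field_simp
      ring
    rw [e1, hθ]
    linarith
  have h2 : Real.exp (2 * x ^ 2 / n) * μ.real {ω | ∑ τ ∈ Finset.range t, B τ ω = n ∧
      x ≤ σ * ∑ τ ∈ Finset.range t, B τ ω * (Y τ ω - W τ ω)} ≤ 1 :=
    (mul_le_mul_of_nonneg_left (measureReal_mono hsub) (Real.exp_pos _).le).trans (hmk.trans h1)
  rw [Real.exp_neg, ← one_div, le_div_iff₀ (Real.exp_pos _), mul_comm]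
  exact h2

end Concentration

/-! ### Conditional means along a sampled episode -/

theorem measurable_apply_of_fintype {Ω α : Type*} {m : MeasurableSpace Ω} [Fintype α]
    [MeasurableSpace α] [MeasurableSingletonClass α] {s : Ω → α} {F : Ω → α → ℝ}
    (hs : Measurable s) (hF : ∀ a, Measurable fun ω => F ω a) : Measurable fun ω => F ω (s ω) := by
  classical
  have : (fun ω => F ω (s ω)) = fun ω => ∑ a, if s ω = a then F ω a else 0 := by
    funext ω; simp
  rw [this]
  exact Finset.measurable_sum _ fun a _ =>
    Measurable.ite (hs (measurableSet_singleton a)) (hF a) measurable_const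

theorem abs_le_one_of_mem_stdSimplex {α : Type*} [Fintype α] {p : α → ℝ} (hp : p ∈ stdSimplex ℝ α)
    (a : α) : |p a| ≤ 1 := by
  rw [abs_of_nonneg (hp.1 a), ← hp.2]
  exact Finset.single_le_sum (fun b _ => hp.1 b) (Finset.mem_univ a)

/-- If the indicators of `x = a` have the conditional means `p a`, then `F x` has the conditional
mean `∑ a, F a * p a` for every random function `F` that is known beforehand. -/
theorem integral_mul_apply_eq {Ω α : Type*} {𝒦 mΩ : MeasurableSpace Ω} {μ : Measure Ω}
    [Fintype α] [DecidableEq α] [IsProbabilityMeasure μ] (h𝒦 : 𝒦 ≤ mΩ) {x : Ω → α} {p F : Ω → α → ℝ}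
    (hx : ∀ a, CondMean μ 𝒦 (fun ω => if x ω = a then 1 else 0) (fun ω => p ω a))
    (hxm : ∀ a, MeasurableSet {ω | x ω = a})
    (hpm : ∀ a, Measurable fun ω => p ω a) (hp1 : ∀ ω a, |p ω a| ≤ 1)
    (hF : ∀ a, Measurable[𝒦] fun ω => F ω a) {c : ℝ} (hFc : ∀ ω a, |F ω a| ≤ c)
    {k : Ω → ℝ} (hk : Measurable[𝒦] k) {C : ℝ} (hC : ∀ᵐ ω ∂μ, |k ω| ≤ C) :
    ∫ ω, k ω * F ω (x ω) ∂μ = ∫ ω, k ω * ∑ a, F ω a * p ω a ∂μ := by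
  have hkF : ∀ a, Measurable[𝒦] fun ω => k ω * F ω a := fun a => hk.mul (hF a)
  have hb : ∀ a, ∀ᵐ ω ∂μ, |k ω * F ω a| ≤ C * c := fun a => by
    filter_upwards [hC] with ω h
    rw [abs_mul]
    exact mul_le_mul h (hFc ω a) (abs_nonneg _) ((abs_nonneg _).trans h)
  have e1 : ∀ ω, k ω * F ω (x ω) = ∑ a, k ω * F ω a * (if x ω = a then 1 else 0) := by
    intro ω; simp
  have e2 : ∀ ω, k ω * ∑ a, F ω a * p ω a = ∑ a, k ω * F ω a * p ω a := by
    intro ω; rw [Finset.mul_sum]; exact Finset.sum_congr rfl fun a _ => by ring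
  simp only [e1, e2]
  have hi : ∀ (a : α) (Z : Ω → ℝ), Measurable Z → (∀ ω, |Z ω| ≤ 1) →
      Integrable (fun ω => k ω * F ω a * Z ω) μ := by
    intro a Z hZ hZ1
    refine integrable_of_abs_le (((hkF a).mono h𝒦 le_rfl).mul hZ) (C * c) ?_
    filter_upwards [hb a] with ω h
    rw [abs_mul]
    exact (mul_le_of_le_one_right (abs_nonneg _) (hZ1 ω)).trans h
  rw [integral_finsetSum _ fun a _ => hi a _ (Measurable.ite (hxm a) measurable_const
      measurable_const) fun ω => by split_ifs <;> simp,
    integral_finsetSum _ fun a _ => hi a _ (hpm a) fun ω => hp1 ω a]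
  exact Finset.sum_congr rfl fun a _ => hx a _ (hkF a) ⟨_, hb a⟩

section Sampled

variable {S A J Ω : Type*} [MeasurableSpace S] [MeasurableSpace A] {H m : ℕ}
  {𝒢 𝒢' : MeasurableSpace Ω} {E : Ω → Episode S A J H}

theorem le_preAction (h : Fin H) : 𝒢 ≤ preAction 𝒢 E h :=
  le_sup_of_le_left (le_sup_of_le_left le_sup_left)

theorem preAction_le_postAction (h : Fin H) : preAction 𝒢 E h ≤ postAction 𝒢 E h := le_sup_left

theorem measurable_state_preAction (h : Fin H) :
    Measurable[preAction 𝒢 E h] fun ω => (E ω).state h.castSucc := by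
  refine Measurable.of_comap_le ?_
  refine le_sup_of_le_left (le_sup_of_le_left (le_sup_of_le_right ?_))
  exact le_iSup (fun k : {k : Fin (H + 1) // k ≤ h.castSucc} =>
    MeasurableSpace.comap (fun ω => (E ω).state k) inferInstance) ⟨h.castSucc, le_rfl⟩

theorem measurable_state_postAction (h : Fin H) :
    Measurable[postAction 𝒢 E h] fun ω => (E ω).state h.castSucc :=
  (measurable_state_preAction h).mono (preAction_le_postAction h) le_rfl

theorem measurable_action_postAction (h : Fin H) :
    Measurable[postAction 𝒢 E h] fun ω => (E ω).action h :=
  Measurable.of_comap_le le_sup_right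

variable [Fintype S] [DecidableEq S] [Fintype A] [DecidableEq A] [mΩ : MeasurableSpace Ω]
  {M : MOMDP S A H m} {obs : J → Fin m} {μ : Measure Ω} {π : Ω → Policy S A H}

theorem IsSampled.postAction_le (hE : IsSampled M obs μ 𝒢 𝒢' π E) (h𝒢 : 𝒢 ≤ 𝒢') (h : Fin H) :
    postAction 𝒢 E h ≤ 𝒢' :=
  sup_le (sup_le (sup_le (sup_le h𝒢 (iSup_le fun k => (hE.state_measurable k).comap_le))
    (iSup_le fun k => (hE.action_measurable k).comap_le))
    (iSup_le fun k => iSup_le fun j => (hE.reward_measurable j k).comap_le))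
    (hE.action_measurable h).comap_le

theorem IsSampled.condMean_reward [IsProbabilityMeasure μ] (hE : IsSampled M obs μ 𝒢 𝒢' π E)
    (h𝒢 : 𝒢 ≤ 𝒢') (h𝒢' : 𝒢' ≤ mΩ) (j : J) (h : Fin H) :
    CondMean μ (postAction 𝒢 E h) (fun ω => (E ω).reward j h)
      (fun ω => M.reward (obs j) h ((E ω).state h.castSucc) ((E ω).action h)) := by
  refine condMean_of_condExp ((hE.postAction_le h𝒢 h).trans h𝒢') ?_ (hE.reward_mean j h)
  refine integrable_of_abs_le ((hE.reward_measurable j h).mono h𝒢' le_rfl) 1 ?_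
  filter_upwards [hE.reward_range j h] with ω hω
  rw [abs_of_nonneg hω.1]
  exact hω.2

theorem IsSampled.condMean_state [MeasurableSingletonClass S] [IsProbabilityMeasure μ]
    (hE : IsSampled M obs μ 𝒢 𝒢' π E)
    (h𝒢 : 𝒢 ≤ 𝒢') (h𝒢' : 𝒢' ≤ mΩ) (h : Fin H) (s' : S) :
    CondMean μ (postAction 𝒢 E h) (fun ω => if (E ω).state h.succ = s' then 1 else 0)
      (fun ω => M.trans h ((E ω).state h.castSucc) ((E ω).action h) s') := by
  refine condMean_of_condExp ((hE.postAction_le h𝒢 h).trans h𝒢') ?_ (hE.state_law h s')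
  refine integrable_of_abs_le (Measurable.ite
    (((hE.state_measurable h.succ).mono h𝒢' le_rfl) (measurableSet_singleton s'))
    measurable_const measurable_const) 1 (ae_of_all _ fun ω => ?_)
  split_ifs <;> simp

theorem IsSampled.condMean_action [MeasurableSingletonClass A] [IsProbabilityMeasure μ]
    (hE : IsSampled M obs μ 𝒢 𝒢' π E)
    (h𝒢 : 𝒢 ≤ 𝒢') (h𝒢' : 𝒢' ≤ mΩ) (h : Fin H) (a : A) :
    CondMean μ (preAction 𝒢 E h) (fun ω => if (E ω).action h = a then 1 else 0)
      (fun ω => (π ω).1 h ((E ω).state h.castSucc) a) := by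
  refine condMean_of_condExp ((preAction_le_postAction h).trans
    ((hE.postAction_le h𝒢 h).trans h𝒢')) ?_ (hE.action_law h a)
  refine integrable_of_abs_le (Measurable.ite
    (((hE.action_measurable h).mono h𝒢' le_rfl) (measurableSet_singleton a))
    measurable_const measurable_const) 1 (ae_of_all _ fun ω => ?_)
  split_ifs <;> simp

theorem IsSampled.condMean_state_mem [MeasurableSingletonClass S] [MeasurableSingletonClass A]
    [IsProbabilityMeasure μ] (hE : IsSampled M obs μ 𝒢 𝒢' π E)
    (h𝒢 : 𝒢 ≤ 𝒢') (h𝒢' : 𝒢' ≤ mΩ) (h : Fin H) (U : Finset S) :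
    CondMean μ (postAction 𝒢 E h) (fun ω => if (E ω).state h.succ ∈ U then 1 else 0)
      (fun ω => ∑ s' ∈ U, M.trans h ((E ω).state h.castSucc) ((E ω).action h) s') := by
  rintro k hk ⟨C, hC⟩
  have hsm : ∀ h, Measurable fun ω => (E ω).state h := fun h =>
    (hE.state_measurable h).mono h𝒢' le_rfl
  have ham : Measurable fun ω => (E ω).action h := (hE.action_measurable h).mono h𝒢' le_rfl
  rw [integral_mul_apply_eq (x := fun ω => (E ω).state h.succ)
    (F := fun _ s' => if s' ∈ U then 1 else 0) (c := 1) ((hE.postAction_le h𝒢 h).trans h𝒢')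
    (fun s' => hE.condMean_state h𝒢 h𝒢' h s') (fun s' => hsm h.succ (measurableSet_singleton s'))
    (fun s' => ?_) (fun ω s' => abs_le_one_of_mem_stdSimplex (M.trans_mem _ _ _) s')
    (fun s' => measurable_const) (fun ω s' => by split_ifs <;> simp) hk hC]
  · simp
  · exact measurable_apply_of_fintype (F := fun ω a => M.trans h ((E ω).state h.castSucc) a s')
      ham fun a => (measurable_of_finite fun s => M.trans h s a s').comp (hsm _)

theorem IsSampled.measurable_polEval (hE : IsSampled M obs μ 𝒢 𝒢' π E)
    {f : Ω → Fin H → S → A → ℝ} (hf : ∀ h s a, Measurable[𝒢] fun ω => f ω h s a)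
    (h : Fin (H + 1)) (s : S) : Measurable[𝒢] fun ω => polEval M (π ω) (f ω) h s := by
  induction h using Fin.reverseInduction generalizing s with
  | last => simp only [polEval_last]; exact measurable_const
  | cast h ih =>
    simp only [polEval_castSucc]
    exact Finset.measurable_sum _ fun a _ => (hE.policy_measurable h s a).mul
      ((hf h s a).add (Finset.measurable_sum _ fun s' _ => (ih s').const_mul _))

/-- The expected total of step rewards `f` that are known before the episode is the policy
evaluation of `f`. The proof telescopes: at every step, reward plus next value minus current value
has conditional mean zero. -/
theorem IsSampled.condMean_total [MeasurableSingletonClass S]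
    [MeasurableSingletonClass A] [IsProbabilityMeasure μ] (hE : IsSampled M obs μ 𝒢 𝒢' π E)
    (h𝒢 : 𝒢 ≤ 𝒢') (h𝒢' : 𝒢' ≤ mΩ) {f : Ω → Fin H → S → A → ℝ}
    (hf : ∀ h s a, Measurable[𝒢] fun ω => f ω h s a) {c : ℝ}
    (hfc : ∀ ω h s a, f ω h s a ∈ Set.Icc 0 c) :
    CondMean μ 𝒢 (fun ω => ∑ h : Fin H, f ω h ((E ω).state h.castSucc) ((E ω).action h))
      (fun ω => polEval M (π ω) (f ω) 0 M.init) := by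
  rintro k hk ⟨C, hC⟩
  set W : Ω → Fin (H + 1) → S → ℝ := fun ω => polEval M (π ω) (f ω) with hW
  have hWm : ∀ h s, Measurable[𝒢] fun ω => W ω h s := hE.measurable_polEval hf
  have hcH : ∀ (ω : Ω) (h : Fin (H + 1)) (s : S), 0 ≤ c → |W ω h s| ≤ c * H := by
    intro ω h s hc
    have := polEval_mem_Icc M (π ω) (hfc ω) h s
    rw [abs_of_nonneg this.1]
    refine this.2.trans (mul_le_mul_of_nonneg_left ?_ hc)
    linarith [Nat.cast_nonneg (α := ℝ) (h : ℕ)]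
  rcases Nat.eq_zero_or_pos H with rfl | hH
  · have h0 : ∀ ω, polEval M (π ω) (f ω) 0 M.init = 0 := fun ω => polEval_last M (π ω) (f ω) M.init
    simp [h0]
  rcases isEmpty_or_nonempty Ω with hΩ | ⟨⟨ω₀⟩⟩
  · simp [Measure.eq_zero_of_isEmpty μ]
  -- Step rewards exist since the policy of `ω₀` plays some action.
  have hc : 0 ≤ c := by
    by_contra hneg
    have he : IsEmpty A := ⟨fun a =>
      hneg ((hfc ω₀ ⟨0, hH⟩ M.init a).1.trans (hfc ω₀ ⟨0, hH⟩ M.init a).2)⟩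
    have := ((π ω₀).2 ⟨0, hH⟩ M.init).2
    simp at this
  have hsm : ∀ h, Measurable fun ω => (E ω).state h := fun h =>
    (hE.state_measurable h).mono h𝒢' le_rfl
  have ham : ∀ h, Measurable fun ω => (E ω).action h := fun h =>
    (hE.action_measurable h).mono h𝒢' le_rfl
  have h𝒢Ω : 𝒢 ≤ mΩ := h𝒢.trans h𝒢'
  -- The value at the next state, given the present state and action.
  have hnext : ∀ h : Fin H, ∫ ω, k ω * W ω h.succ ((E ω).state h.succ) ∂μ =
      ∫ ω, k ω *
        ∑ s', M.trans h ((E ω).state h.castSucc) ((E ω).action h) s' * W ω h.succ s' ∂μ := by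
    intro h
    have hle : 𝒢 ≤ postAction 𝒢 E h := (le_preAction h).trans (preAction_le_postAction h)
    rw [integral_mul_apply_eq ((hE.postAction_le h𝒢 h).trans h𝒢')
      (fun s' => hE.condMean_state h𝒢 h𝒢' h s') (fun s' => hsm h.succ (measurableSet_singleton s'))
      (fun s' => ?_) (fun ω s' => abs_le_one_of_mem_stdSimplex (M.trans_mem _ _ _) s')
      (F := fun ω s' => W ω h.succ s') (fun s' => (hWm h.succ s').mono hle le_rfl)
      (fun ω s' => hcH ω _ s' hc) (hk.mono hle le_rfl) hC]
    · simp only [mul_comm]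
    · exact measurable_apply_of_fintype (F := fun ω a => M.trans h ((E ω).state h.castSucc) a s')
        (ham h) fun a => (measurable_of_finite fun s => M.trans h s a s').comp (hsm _)
  -- Reward plus expected next value, given the present state.
  have hstep : ∀ h : Fin H, ∫ ω, k ω * (f ω h ((E ω).state h.castSucc) ((E ω).action h) +
      ∑ s', M.trans h ((E ω).state h.castSucc) ((E ω).action h) s' * W ω h.succ s') ∂μ =
      ∫ ω, k ω * W ω h.castSucc ((E ω).state h.castSucc) ∂μ := by
    intro h
    have hFm : ∀ s a, Measurable[𝒢] fun ω =>
        f ω h s a + ∑ s', M.trans h s a s' * W ω h.succ s' := fun s a =>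
      (hf h s a).add (Finset.measurable_sum _ fun s' _ => (hWm _ s').const_mul _)
    rw [integral_mul_apply_eq (x := fun ω => (E ω).action h)
      ((preAction_le_postAction h).trans ((hE.postAction_le h𝒢 h).trans h𝒢'))
      (fun a => hE.condMean_action h𝒢 h𝒢' h a) (fun a => ham h (measurableSet_singleton a))
      (fun a => ?_) (fun ω a => abs_le_one_of_mem_stdSimplex ((π ω).2 _ _) a)
      (F := fun ω a => f ω h ((E ω).state h.castSucc) a +
        ∑ s', M.trans h ((E ω).state h.castSucc) a s' * W ω h.succ s')
      (fun a => ?_) (c := c + c * H) (fun ω a => ?_) (hk.mono (le_preAction h) le_rfl) hC]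
    · refine integral_congr_ae (ae_of_all _ fun ω => ?_)
      simp only [hW, polEval_castSucc]
      congr 1
      exact Finset.sum_congr rfl fun a _ => mul_comm _ _
    · exact measurable_apply_of_fintype (F := fun ω s => (π ω).1 h s a) (hsm _)
        fun s => (hE.policy_measurable h s a).mono h𝒢Ω le_rfl
    · exact measurable_apply_of_fintype (m := preAction 𝒢 E h)
        (F := fun ω s => f ω h s a + ∑ s', M.trans h s a s' * W ω h.succ s')
        (measurable_state_preAction h) fun s => (hFm s a).mono (le_preAction h) le_rfl
    · refine (abs_add_le _ _).trans (add_le_add ?_ ?_)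
      · rw [abs_of_nonneg (hfc _ _ _ _).1]; exact (hfc _ _ _ _).2
      · have ht := M.trans_mem h ((E ω).state h.castSucc) a
        refine (Finset.abs_sum_le_sum_abs _ _).trans ?_
        calc _ ≤ ∑ s', M.trans h ((E ω).state h.castSucc) a s' * (c * H) := by
              refine Finset.sum_le_sum fun s' _ => ?_
              rw [abs_mul, abs_of_nonneg (ht.1 s')]
              exact mul_le_mul_of_nonneg_left (hcH _ _ _ hc) (ht.1 s')
          _ = _ := by rw [← Finset.sum_mul, ht.2, one_mul]
  have hint : ∀ {Z : Ω → ℝ} {b : ℝ}, Measurable Z → (∀ ω, |Z ω| ≤ b) →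
      Integrable (fun ω => k ω * Z ω) μ := by
    intro Z b hZ hb
    refine integrable_of_abs_le ((hk.mono h𝒢Ω le_rfl).mul hZ) (C * b) ?_
    filter_upwards [hC] with ω h
    rw [abs_mul]
    exact mul_le_mul h (hb ω) (abs_nonneg _) ((abs_nonneg _).trans h)
  have hVm : ∀ h : Fin (H + 1), Measurable fun ω => W ω h ((E ω).state h) := fun h =>
    measurable_apply_of_fintype (F := fun ω s => W ω h s) (hsm h)
      fun s => (hWm h s).mono h𝒢Ω le_rfl
  have hfm : ∀ h : Fin H, Measurable fun ω => f ω h ((E ω).state h.castSucc) ((E ω).action h) :=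
    fun h => measurable_apply_of_fintype
      (F := fun ω a => f ω h ((E ω).state h.castSucc) a) (ham h) fun a =>
        measurable_apply_of_fintype (F := fun ω s => f ω h s a) (hsm _)
          fun s => (hf h s a).mono h𝒢Ω le_rfl
  have hVi : ∀ h : Fin (H + 1), Integrable (fun ω => k ω * W ω h ((E ω).state h)) μ := fun h =>
    hint (hVm h) fun ω => hcH _ _ _ hc
  have hfi : ∀ h : Fin H, Integrable
      (fun ω => k ω * f ω h ((E ω).state h.castSucc) ((E ω).action h)) μ := fun h =>
    hint (hfm h) (b := c) fun ω => by
      rw [abs_of_nonneg (hfc _ _ _ _).1]; exact (hfc _ _ _ _).2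
  have hone : ∀ h : Fin H, ∫ ω, k ω * f ω h ((E ω).state h.castSucc) ((E ω).action h) ∂μ =
      ∫ ω, k ω * W ω h.castSucc ((E ω).state h.castSucc) ∂μ -
        ∫ ω, k ω * W ω h.succ ((E ω).state h.succ) ∂μ := by
    intro h
    have hPi : Integrable (fun ω => k ω *
        ∑ s', M.trans h ((E ω).state h.castSucc) ((E ω).action h) s' * W ω h.succ s') μ := by
      refine hint (b := c * H) ?_ fun ω => ?_
      · exact Finset.measurable_sum _ fun s' _ => Measurable.mul
          (measurable_apply_of_fintype
            (F := fun ω a => M.trans h ((E ω).state h.castSucc) a s') (ham h)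
            fun a => (measurable_of_finite fun s => M.trans h s a s').comp (hsm _))
          ((hWm _ s').mono h𝒢Ω le_rfl)
      · have ht := M.trans_mem h ((E ω).state h.castSucc) ((E ω).action h)
        refine (Finset.abs_sum_le_sum_abs _ _).trans ?_
        calc _ ≤ ∑ s', M.trans h ((E ω).state h.castSucc) ((E ω).action h) s' * (c * H) := by
              refine Finset.sum_le_sum fun s' _ => ?_
              rw [abs_mul, abs_of_nonneg (ht.1 s')]
              exact mul_le_mul_of_nonneg_left (hcH _ _ _ hc) (ht.1 s')
          _ = _ := by rw [← Finset.sum_mul, ht.2, one_mul]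
    rw [hnext h, ← hstep h, ← integral_sub _ hPi]
    · exact integral_congr_ae (ae_of_all _ fun ω => by ring)
    · simp only [mul_add]
      exact (hfi h).add hPi
  simp only [Finset.mul_sum]
  rw [integral_finsetSum _ fun h _ => hfi h, Finset.sum_congr rfl fun h _ => hone h,
    Finset.sum_sub_distrib]
  have t1 := Fin.sum_univ_castSucc fun h : Fin (H + 1) => ∫ ω, k ω * W ω h ((E ω).state h) ∂μ
  have t2 := Fin.sum_univ_succ fun h : Fin (H + 1) => ∫ ω, k ω * W ω h ((E ω).state h) ∂μ
  have t3 : ∫ ω, k ω * W ω (Fin.last H) ((E ω).state (Fin.last H)) ∂μ = 0 := by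
    simp [hW, polEval_last]
  have t4 : ∫ ω, k ω * W ω 0 ((E ω).state 0) ∂μ = ∫ ω, k ω * W ω 0 M.init ∂μ := by
    refine integral_congr_ae ?_
    filter_upwards [hE.init_state] with ω h
    rw [h]
  linarith

end Sampled

/-! ### Optimistic planning with accurate estimates -/

section Planning

variable {S A J : Type*} [Fintype S] [DecidableEq S] [Fintype A] [DecidableEq A] {H m : ℕ}

/-- The estimates built from the episodes `1, …, t` of `D` are within the bonuses of the truth: the
rewards pointwise, the transitions uniformly over all value functions with values in `[0, H]`. -/
structure IsAccurate (M : MOMDP S A H m) (obs : J → Fin m) (T : ℕ) (δ : ℝ)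
    (D : ℕ → Episode S A J H) (t : ℕ) : Prop where
  reward : ∀ j h s a,
    |rewardEst D j t h s a - M.reward (obs j) h s a| ≤ rewardBonus m T δ D t h s a
  trans : ∀ h s a (V : S → ℝ), (∀ s', V s' ∈ Set.Icc (0 : ℝ) H) →
    |∑ s', transEst D t h s a s' * V s' - ∑ s', M.trans h s a s' * V s'| ≤
      transBonus m T δ D t h s a

/-- One round of optimistic planning: the value functions `V j` and Q-functions `Q j` are built
from the episodes `1, …, t` of `D`, for a policy `π` that is greedy with respect to the weighted
sum `∑ j, c j * Q j`. -/
structure IsPlan (m T : ℕ) (δ : ℝ) (D : ℕ → Episode S A J H) (t : ℕ) [Fintype J] (c : J → ℝ)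
    (V : J → Fin (H + 1) → S → ℝ) (Q : J → Fin H → S → A → ℝ) (π : Policy S A H) : Prop where
  last : ∀ j s, V j (Fin.last H) s = 0
  step : ∀ j (h : Fin H) s, V j h.castSucc s = ∑ a, Q j h s a * π.1 h s a
  optimistic : ∀ j (h : Fin H) s a, Q j h s a = optQ m T δ D j t h (V j h.succ) s a
  greedy : ∀ h s, IsGreedy (fun a => ∑ j, c j * Q j h s a) (π.1 h s)

variable {T t : ℕ} {δ : ℝ} {D : ℕ → Episode S A J H}

theorem optQ_mem_Icc (j : J) (h : Fin H) (V : S → ℝ) (s : S) (a : A) :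
    optQ m T δ D j t h V s a ∈ Set.Icc (0 : ℝ) ((H : ℝ) - (h : ℕ)) := by
  have : ((h : ℕ) : ℝ) ≤ H := by exact_mod_cast h.2.le
  exact ⟨le_max_right _ _, max_le (min_le_right _ _) (by linarith)⟩

theorem sum_mul_mem_Icc {α : Type*} [Fintype α] {p q : α → ℝ} {c : ℝ} (hp : p ∈ stdSimplex ℝ α)
    (hq : ∀ a, q a ∈ Set.Icc 0 c) : ∑ a, p a * q a ∈ Set.Icc 0 c := by
  refine ⟨Finset.sum_nonneg fun a _ => mul_nonneg (hp.1 a) (hq a).1, ?_⟩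
  calc _ ≤ ∑ a, p a * c := Finset.sum_le_sum fun a _ => mul_le_mul_of_nonneg_left (hq a).2 (hp.1 a)
    _ = c := by rw [← Finset.sum_mul, hp.2, one_mul]

variable [Fintype J] {c : J → ℝ} {V : J → Fin (H + 1) → S → ℝ} {Q : J → Fin H → S → A → ℝ}
  {π : Policy S A H} {M : MOMDP S A H m} {obs : J → Fin m}

theorem IsPlan.value_mem_Icc (hP : IsPlan m T δ D t c V Q π) (j : J) (h : Fin (H + 1)) (s : S) :
    V j h s ∈ Set.Icc (0 : ℝ) ((H : ℝ) - (h : ℕ)) := by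
  induction h using Fin.reverseInduction generalizing s with
  | last => rw [hP.last]; simp
  | cast h ih =>
    rw [hP.step, Finset.sum_congr rfl fun a _ => mul_comm (Q j h s a) (π.1 h s a)]
    simp only [hP.optimistic]
    exact sum_mul_mem_Icc (π.2 h s) fun a => optQ_mem_Icc j h _ s a

theorem IsPlan.value_mem_Icc_horizon (hP : IsPlan m T δ D t c V Q π) (j : J) (h : Fin (H + 1))
    (s : S) : V j h s ∈ Set.Icc (0 : ℝ) H := by
  have := hP.value_mem_Icc j h s
  exact ⟨this.1, this.2.trans (by linarith [Nat.cast_nonneg (α := ℝ) (h : ℕ)])⟩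

/-- The optimistic Q-function dominates the true Bellman update of the same next value function.
Clipping at the top does no harm because the Bellman update is at most the remaining horizon. -/
theorem IsPlan.bellman_le (hP : IsPlan m T δ D t c V Q π) (hA : IsAccurate M obs T δ D t)
    (j : J) (h : Fin H) (s : S) (a : A) :
    M.reward (obs j) h s a + ∑ s', M.trans h s a s' * V j h.succ s' ≤ Q j h s a := by
  have hr := M.reward_mem (obs j) h s a
  have hv := sum_mul_mem_Icc (M.trans_mem h s a) fun s' => hP.value_mem_Icc j h.succ s'
  have h1 := abs_le.mp (hA.reward j h s a)
  have h2 := abs_le.mp (hA.trans h s a _ (hP.value_mem_Icc_horizon j h.succ))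
  rw [hP.optimistic]
  refine le_max_of_le_left (le_min (by linarith) ?_)
  have := hv.2
  simp only [Fin.val_succ, Nat.cast_add, Nat.cast_one] at this
  linarith [hr.2]

theorem IsPlan.le_bellman_add (hP : IsPlan m T δ D t c V Q π) (hA : IsAccurate M obs T δ D t)
    (j : J) (h : Fin H) (s : S) (a : A) :
    Q j h s a ≤ M.reward (obs j) h s a + ∑ s', M.trans h s a s' * V j h.succ s' +
      2 * (rewardBonus m T δ D t h s a + transBonus m T δ D t h s a) := by
  have hr := M.reward_mem (obs j) h s a
  have hv := sum_mul_mem_Icc (M.trans_mem h s a) fun s' => hP.value_mem_Icc j h.succ s'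
  have h1 := abs_le.mp (hA.reward j h s a)
  have h2 := abs_le.mp (hA.trans h s a _ (hP.value_mem_Icc_horizon j h.succ))
  rw [hP.optimistic]
  refine max_le ((min_le_left _ _).trans (by linarith)) ?_
  linarith [hr.1, hv.1]

/-- Optimism for the weighted values. It cannot hold objective by objective, since the policy is
greedy for the weighted sum only; the accuracy of the transition estimates uniformly over value
functions is what allows to compare the weighted sums directly. -/
theorem IsPlan.sum_value_le (hP : IsPlan m T δ D t c V Q π) (hA : IsAccurate M obs T δ D t)
    (hc : ∀ j, 0 ≤ c j) (ρ : Policy S A H) :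
    ∑ j, c j * value M (obs j) ρ ≤ ∑ j, c j * V j 0 M.init := by
  simp only [value_eq_polEval]
  suffices h : ∀ (h : Fin (H + 1)) (s : S),
      ∑ j, c j * polEval M ρ (M.reward (obs j)) h s ≤ ∑ j, c j * V j h s from h 0 _
  intro h
  induction h using Fin.reverseInduction with
  | last => intro s; simp [hP.last, polEval_last]
  | cast h ih =>
    intro s
    have e1 : ∑ j, c j * polEval M ρ (M.reward (obs j)) h.castSucc s =
        ∑ a, ρ.1 h s a * (∑ j, c j * M.reward (obs j) h s a + ∑ s', M.trans h s a s' *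
          ∑ j, c j * polEval M ρ (M.reward (obs j)) h.succ s') := by
      simp only [polEval_castSucc, Finset.mul_sum]
      rw [Finset.sum_comm]
      refine Finset.sum_congr rfl fun a _ => ?_
      rw [Finset.sum_comm, mul_add, Finset.mul_sum, Finset.mul_sum, ← Finset.sum_add_distrib]
      refine Finset.sum_congr rfl fun j _ => ?_
      rw [mul_add, mul_add, Finset.mul_sum, Finset.mul_sum, Finset.mul_sum]
      congr 1
      · ring
      · exact Finset.sum_congr rfl fun s' _ => by ring
    have e2 : ∑ j, c j * V j h.castSucc s = ∑ a, (∑ j, c j * Q j h s a) * π.1 h s a := by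
      simp only [hP.step, Finset.mul_sum, Finset.sum_mul]
      rw [Finset.sum_comm]
      exact Finset.sum_congr rfl fun a _ => Finset.sum_congr rfl fun j _ => by ring
    rw [e1, e2]
    refine le_trans ?_ (hP.greedy h s (ρ.2 h s))
    refine Finset.sum_le_sum fun a _ => ?_
    rw [mul_comm]
    refine mul_le_mul_of_nonneg_right ?_ ((ρ.2 h s).1 a)
    calc _ ≤ ∑ j, c j * M.reward (obs j) h s a + ∑ s', M.trans h s a s' *
          ∑ j, c j * V j h.succ s' := by
          exact add_le_add le_rfl (Finset.sum_le_sum fun s' _ =>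
            mul_le_mul_of_nonneg_left (ih s') ((M.trans_mem h s a).1 s'))
      _ = ∑ j, c j * (M.reward (obs j) h s a + ∑ s', M.trans h s a s' * V j h.succ s') := by
          simp only [mul_add, Finset.sum_add_distrib, Finset.mul_sum]
          congr 1
          rw [Finset.sum_comm]
          exact Finset.sum_congr rfl fun a _ => Finset.sum_congr rfl fun j _ => by ring
      _ ≤ _ := Finset.sum_le_sum fun j _ =>
          mul_le_mul_of_nonneg_left (hP.bellman_le hA j h s a) (hc j)

/-- The overestimation of the optimistic values satisfies a Bellman recursion with twice the sum of
the bonuses as rewards. -/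
theorem IsPlan.value_sub_le (hP : IsPlan m T δ D t c V Q π) (hA : IsAccurate M obs T δ D t)
    (j : J) : V j 0 M.init - value M (obs j) π ≤ 2 * polEval M π
      (fun h s a => rewardBonus m T δ D t h s a + transBonus m T δ D t h s a) 0 M.init := by
  rw [value_eq_polEval, ← polEval_const_mul]
  suffices h : ∀ (h : Fin (H + 1)) (s : S), V j h s ≤ polEval M π (M.reward (obs j)) h s +
      polEval M π (fun h s a =>
        2 * (rewardBonus m T δ D t h s a + transBonus m T δ D t h s a)) h s by
    linarith [h 0 M.init]
  intro h
  induction h using Fin.reverseInduction with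
  | last => intro s; simp [hP.last, polEval_last]
  | cast h ih =>
    intro s
    rw [hP.step, polEval_castSucc, polEval_castSucc, ← Finset.sum_add_distrib]
    refine Finset.sum_le_sum fun a _ => ?_
    rw [mul_comm, ← mul_add]
    refine mul_le_mul_of_nonneg_left ?_ ((π.2 h s).1 a)
    have h1 := hP.le_bellman_add hA j h s a
    have h2 : ∑ s', M.trans h s a s' * V j h.succ s' ≤
        ∑ s', M.trans h s a s' * polEval M π (M.reward (obs j)) h.succ s' +
        ∑ s', M.trans h s a s' * polEval M π (fun h s a =>
          2 * (rewardBonus m T δ D t h s a + transBonus m T δ D t h s a)) h.succ s' := by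
      rw [← Finset.sum_add_distrib]
      refine Finset.sum_le_sum fun s' _ => ?_
      rw [← mul_add]
      exact mul_le_mul_of_nonneg_left (ih s') ((M.trans_mem h s a).1 s')
    linarith

end Planning

/-! ### Counting visits -/

section Counting

variable {S A J : Type*} [DecidableEq S] [DecidableEq A] {H m : ℕ}

/-- The indicator that an episode visits the pair `(s, a)` at step `h`. -/
def visitInd (h : Fin H) (s : S) (a : A) (E : Episode S A J H) : ℝ :=
  if E.state h.castSucc = s ∧ E.action h = a then 1 else 0

theorem visitInd_eq_zero_or_one (h : Fin H) (s : S) (a : A) (E : Episode S A J H) :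
    visitInd h s a E = 0 ∨ visitInd h s a E = 1 := by
  unfold visitInd; split_ifs <;> simp

theorem visits_eq_sum (D : ℕ → Episode S A J H) (t : ℕ) (h : Fin H) (s : S) (a : A) :
    (visits D t h s a : ℝ) = ∑ τ ∈ Finset.range t, visitInd h s a (D (τ + 1)) := by
  rw [visits, Finset.card_filter, Finset.range_eq_Ico,
    Finset.sum_Ico_add' (fun τ => visitInd h s a (D τ)) 0 t 1]
  push_cast
  rfl

theorem visits_succ (D : ℕ → Episode S A J H) (t : ℕ) (h : Fin H) (s : S) (a : A) :
    (visits D (t + 1) h s a : ℝ) = visits D t h s a + visitInd h s a (D (t + 1)) := by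
  rw [visits_eq_sum, visits_eq_sum, Finset.sum_range_succ]

theorem visits_le (D : ℕ → Episode S A J H) (t : ℕ) (h : Fin H) (s : S) (a : A) :
    visits D t h s a ≤ t := by
  refine (Finset.card_filter_le _ _).trans ?_
  simp

theorem rewardEst_eq (D : ℕ → Episode S A J H) (j : J) (t : ℕ) (h : Fin H) (s : S) (a : A) :
    rewardEst D j t h s a = (∑ τ ∈ Finset.range t, visitInd h s a (D (τ + 1)) *
      (D (τ + 1)).reward j h) / max (visits D t h s a : ℝ) 1 := by
  rw [rewardEst, Finset.range_eq_Ico,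
    Finset.sum_Ico_add' (fun τ => visitInd h s a (D τ) * (D τ).reward j h) 0 t 1]
  congr 1
  refine Finset.sum_congr rfl fun τ _ => ?_
  simp [visitInd]

theorem sum_transEst_eq (D : ℕ → Episode S A J H) (t : ℕ) (h : Fin H) (s : S) (a : A)
    (U : Finset S) :
    ∑ s' ∈ U, transEst D t h s a s' = (∑ τ ∈ Finset.range t, visitInd h s a (D (τ + 1)) *
      (if (D (τ + 1)).state h.succ ∈ U then 1 else 0)) / max (visits D t h s a : ℝ) 1 := by
  simp only [transEst]
  rw [← Finset.sum_div, Finset.range_eq_Ico, Finset.sum_Ico_add' (fun τ => visitInd h s a (D τ) *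
    (if (D τ).state h.succ ∈ U then (1 : ℝ) else 0)) 0 t 1]
  congr 1
  have : ∀ s', (visitsNext D t h s a s' : ℝ) = ∑ τ ∈ Finset.Icc 1 t,
      visitInd h s a (D τ) * (if (D τ).state h.succ = s' then (1 : ℝ) else 0) := by
    intro s'
    rw [visitsNext, Finset.card_filter]
    push_cast
    refine Finset.sum_congr rfl fun τ _ => ?_
    simp only [visitInd]
    split_ifs <;> simp_all
  simp only [this]
  rw [Finset.sum_comm]
  refine Finset.sum_congr rfl fun τ _ => ?_
  rw [← Finset.mul_sum]
  congr 1
  simp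

theorem visitInd_mul_sub (h : Fin H) (s : S) (a : A) (E : Episode S A J H) (y : ℝ)
    (f : S → A → ℝ) : visitInd h s a E * (y - f (E.state h.castSucc) (E.action h)) =
      visitInd h s a E * y - f s a * visitInd h s a E := by
  unfold visitInd
  split_ifs with hv
  · rw [hv.1, hv.2]; ring
  · ring

theorem transEst_nonneg (D : ℕ → Episode S A J H) (t : ℕ) (h : Fin H) (s : S) (a : A) (s' : S) :
    0 ≤ transEst D t h s a s' := by
  unfold transEst; positivity

theorem measurable_visitInd {Ω : Type*} {m' : MeasurableSpace Ω} [MeasurableSpace S]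
    [MeasurableSingletonClass S] [MeasurableSpace A] [MeasurableSingletonClass A]
    {E : Ω → Episode S A J H} {h : Fin H}
    (hs : Measurable[m'] fun ω => (E ω).state h.castSucc)
    (ha : Measurable[m'] fun ω => (E ω).action h) (s : S) (a : A) :
    Measurable[m'] fun ω => visitInd h s a (E ω) :=
  Measurable.ite (@MeasurableSet.inter Ω m' _ _ (hs (measurableSet_singleton s))
    (ha (measurableSet_singleton a))) measurable_const measurable_const

theorem inv_sqrt_le (n : ℕ) :
    1 / Real.sqrt (max (n : ℝ) 1) ≤ 3 * (Real.sqrt (n + 1) - Real.sqrt n) := by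
  rcases Nat.eq_zero_or_pos n with rfl | hn
  · simp
  have hn1 : (1 : ℝ) ≤ n := by exact_mod_cast hn
  rw [max_eq_left hn1]
  have h0 : 0 < Real.sqrt n := Real.sqrt_pos.mpr (by linarith)
  have h1 := Real.sq_sqrt (by linarith : (0 : ℝ) ≤ n)
  have h2 := Real.sq_sqrt (by linarith : (0 : ℝ) ≤ (n : ℝ) + 1)
  have h3 := Real.sqrt_nonneg ((n : ℝ) + 1)
  set x := Real.sqrt n
  set y := Real.sqrt ((n : ℝ) + 1)
  -- `(y - x) * (y + x) = 1` and `y ≤ 2 * x`.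
  have hyx : y ≤ 2 * x := by
    by_contra hcon
    nlinarith
  have h4 : (y - x) * (y + x) = 1 := by ring_nf; linarith
  have h5 : 0 ≤ y - x := by
    by_contra hcon
    nlinarith
  rw [div_le_iff₀ h0]
  nlinarith

variable [Fintype S] [Fintype A]

theorem sum_visits (D : ℕ → Episode S A J H) (t : ℕ) (h : Fin H) :
    ∑ s, ∑ a, (visits D t h s a : ℝ) = t := by
  induction t with
  | zero => simp [visits]
  | succ t ih =>
    simp only [visits_succ, Finset.sum_add_distrib, ih, visitInd, ite_and]
    simp

/-- The potential argument for the sum of the inverse square roots of the visit counts along the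
visited pairs. -/
theorem sum_inv_sqrt_visits_le (D : ℕ → Episode S A J H) (h : Fin H) (t : ℕ) :
    ∑ τ ∈ Finset.range t, 1 / Real.sqrt (max (visits D τ h ((D (τ + 1)).state h.castSucc)
      ((D (τ + 1)).action h) : ℝ) 1) ≤ 3 * ∑ s, ∑ a, Real.sqrt (visits D t h s a) := by
  induction t with
  | zero => simp [visits]
  | succ t ih =>
    rw [Finset.sum_range_succ]
    have key : ∑ s, ∑ a, Real.sqrt (visits D (t + 1) h s a) =
        ∑ s, ∑ a, Real.sqrt (visits D t h s a) +
        (Real.sqrt (visits D t h ((D (t + 1)).state h.castSucc) ((D (t + 1)).action h) + 1) -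
          Real.sqrt (visits D t h ((D (t + 1)).state h.castSucc) ((D (t + 1)).action h))) := by
      have : ∀ s a, Real.sqrt (visits D (t + 1) h s a) = Real.sqrt (visits D t h s a) +
          (if (D (t + 1)).state h.castSucc = s then if (D (t + 1)).action h = a then
            Real.sqrt (visits D t h s a + 1) - Real.sqrt (visits D t h s a) else 0 else 0) := by
        intro s a
        rw [visits_succ, visitInd, ite_and]
        split_ifs <;> simp
      simp only [this, Finset.sum_add_distrib]
      simp
    rw [key, mul_add]
    exact add_le_add ih (inv_sqrt_le _)

theorem sum_sqrt_visits_le (D : ℕ → Episode S A J H) (h : Fin H) (t : ℕ) :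
    ∑ s, ∑ a, Real.sqrt (visits D t h s a) ≤
      Real.sqrt (Fintype.card S * Fintype.card A * t) := by
  refine Real.le_sqrt_of_sq_le ?_
  rw [← Fintype.sum_prod_type' (f := fun s a => Real.sqrt (visits D t h s a))]
  refine sq_sum_le_card_mul_sum_sq.trans (le_of_eq ?_)
  simp only [Real.sq_sqrt (Nat.cast_nonneg _)]
  rw [Fintype.sum_prod_type, sum_visits, Finset.card_univ, Fintype.card_prod]
  push_cast
  ring

/-- The bonuses collected along the episodes of `T` rounds. -/
theorem sum_bonus_le (D : ℕ → Episode S A J H) (T : ℕ) (δ : ℝ) :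
    ∑ t ∈ Finset.range T, ∑ h : Fin H,
      (rewardBonus m T δ D t h ((D (t + 1)).state h.castSucc) ((D (t + 1)).action h) +
        transBonus m T δ D t h ((D (t + 1)).state h.castSucc) ((D (t + 1)).action h)) ≤
      (Real.sqrt (2 * bonusLog S A H m T δ) +
        Real.sqrt (2 * (H : ℝ) ^ 2 * Fintype.card S * bonusLog S A H m T δ)) *
        (H * (3 * Real.sqrt (Fintype.card S * Fintype.card A * T))) := by
  rw [Finset.sum_comm]
  set K := Real.sqrt (2 * bonusLog S A H m T δ) +
        Real.sqrt (2 * (H : ℝ) ^ 2 * Fintype.card S * bonusLog S A H m T δ) with hK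
  have hK0 : 0 ≤ K := by positivity
  have h1 : ∀ (h : Fin H) (t : ℕ),
      rewardBonus m T δ D t h ((D (t + 1)).state h.castSucc) ((D (t + 1)).action h) +
        transBonus m T δ D t h ((D (t + 1)).state h.castSucc) ((D (t + 1)).action h) ≤
      K * (1 / Real.sqrt (max (visits D t h ((D (t + 1)).state h.castSucc)
      ((D (t + 1)).action h) : ℝ) 1)) := by
    intro h t
    rw [hK, mul_one_div, add_div, ← Real.sqrt_div' _ (by positivity),
      ← Real.sqrt_div' _ (by positivity)]
    exact add_le_add (min_le_left _ _) (min_le_left _ _)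
  have h2 : ∀ h : Fin H, ∑ t ∈ Finset.range T,
      (rewardBonus m T δ D t h ((D (t + 1)).state h.castSucc) ((D (t + 1)).action h) +
        transBonus m T δ D t h ((D (t + 1)).state h.castSucc) ((D (t + 1)).action h)) ≤
      K * (3 * Real.sqrt (Fintype.card S * Fintype.card A * T)) := by
    intro h
    refine (Finset.sum_le_sum fun t _ => h1 h t).trans ?_
    rw [← Finset.mul_sum]
    refine mul_le_mul_of_nonneg_left ((sum_inv_sqrt_visits_le D h T).trans ?_) hK0
    exact mul_le_mul_of_nonneg_left (sum_sqrt_visits_le D h T) (by norm_num)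
  refine (Finset.sum_le_sum fun h _ => h2 h).trans (le_of_eq ?_)
  simp
  ring

end Counting

/-! ### The confidence event of one stream of episodes -/

section ConfidenceEvent

variable {S A J : Type*} [Fintype S] [DecidableEq S] [Fintype A] [DecidableEq A] {H m : ℕ}

/-- The deviations, along the episodes `1, …, t`, of the observed rewards and of the visits of
every set of next states from their conditional means are of the order of the bonuses. -/
structure IsConcentrated (M : MOMDP S A H m) (obs : J → Fin m) (T : ℕ) (δ : ℝ)
    (D : ℕ → Episode S A J H) (t : ℕ) : Prop where
  range : ∀ τ < t, ∀ j h, (D (τ + 1)).reward j h ∈ Set.Icc (0 : ℝ) 1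
  reward : ∀ j h s a, 1 ≤ visits D t h s a →
    |∑ τ ∈ Finset.range t, visitInd h s a (D (τ + 1)) * ((D (τ + 1)).reward j h -
      M.reward (obs j) h ((D (τ + 1)).state h.castSucc) ((D (τ + 1)).action h))| ≤
      Real.sqrt (2 * bonusLog S A H m T δ * visits D t h s a)
  trans : ∀ h s a (U : Finset S), 1 ≤ visits D t h s a →
    |∑ τ ∈ Finset.range t, visitInd h s a (D (τ + 1)) *
      ((if (D (τ + 1)).state h.succ ∈ U then 1 else 0) -
      ∑ s' ∈ U, M.trans h ((D (τ + 1)).state h.castSucc) ((D (τ + 1)).action h) s')| ≤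
      Real.sqrt (2 * (Fintype.card S * bonusLog S A H m T δ) * visits D t h s a)

variable {M : MOMDP S A H m} {obs : J → Fin m} {T t : ℕ} {δ : ℝ} {D : ℕ → Episode S A J H}

theorem abs_div_le_sqrt_div {x K n : ℝ} (hn : 0 < n) (h : |x| ≤ Real.sqrt (K * n)) :
    |x / n| ≤ Real.sqrt (K / n) := by
  rw [abs_div, abs_of_pos hn, div_le_iff₀ hn]
  refine h.trans (le_of_eq ?_)
  rw [← Real.sqrt_sq hn.le, ← Real.sqrt_mul' _ (sq_nonneg _), Real.sqrt_sq hn.le]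
  congr 1
  field_simp

theorem IsConcentrated.abs_rewardEst_sub_le (hD : IsConcentrated M obs T δ D t)
    (hL : 1 / 2 ≤ bonusLog S A H m T δ) (j : J) (h : Fin H) (s : S) (a : A) :
    |rewardEst D j t h s a - M.reward (obs j) h s a| ≤ rewardBonus m T δ D t h s a := by
  have hr := M.reward_mem (obs j) h s a
  have hi : ∀ τ ∈ Finset.range t, 0 ≤ visitInd h s a (D (τ + 1)) * (D (τ + 1)).reward j h ∧
      visitInd h s a (D (τ + 1)) * (D (τ + 1)).reward j h ≤ visitInd h s a (D (τ + 1)) := by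
    intro τ hτ
    have := hD.range τ (Finset.mem_range.mp hτ) j h
    rcases visitInd_eq_zero_or_one h s a (D (τ + 1)) with e | e <;> rw [e] <;> simp [this.1, this.2]
  have hsum1 := Finset.sum_le_sum fun τ hτ => (hi τ hτ).2
  have hsum0 := Finset.sum_nonneg fun τ hτ => (hi τ hτ).1
  rw [← visits_eq_sum] at hsum1
  rcases Nat.eq_zero_or_pos (visits D t h s a) with h0 | hpos
  · rw [rewardBonus, rewardEst_eq, h0]
    rw [h0, Nat.cast_zero] at hsum1
    rw [le_antisymm hsum1 hsum0, zero_div, zero_sub, abs_neg, abs_of_nonneg hr.1]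
    refine le_min (hr.2.trans (Real.one_le_sqrt.mpr ?_)) hr.2
    simp
    linarith
  · have hn : (1 : ℝ) ≤ visits D t h s a := by exact_mod_cast hpos
    have hn0 : (0 : ℝ) < visits D t h s a := by linarith
    have hc := hD.reward j h s a hpos
    simp only [fun τ => visitInd_mul_sub h s a (D (τ + 1)) ((D (τ + 1)).reward j h)
      (M.reward (obs j) h)] at hc
    rw [Finset.sum_sub_distrib, ← Finset.mul_sum, ← visits_eq_sum] at hc
    rw [rewardBonus, rewardEst_eq, max_eq_left hn]
    have e : (∑ τ ∈ Finset.range t, visitInd h s a (D (τ + 1)) * (D (τ + 1)).reward j h) /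
        (visits D t h s a : ℝ) - M.reward (obs j) h s a =
        (∑ τ ∈ Finset.range t, visitInd h s a (D (τ + 1)) * (D (τ + 1)).reward j h -
          M.reward (obs j) h s a * visits D t h s a) / (visits D t h s a : ℝ) := by
      field_simp
    refine le_min ?_ ?_
    · rw [e]
      exact abs_div_le_sqrt_div hn0 hc
    · have h1 := div_nonneg hsum0 hn0.le
      have h2 := (div_le_one hn0).mpr hsum1
      rw [abs_le]
      constructor <;> linarith [hr.1, hr.2]

/-- A bound on the masses of all sets under a signed weight `d` bounds the integrals of functions
with values in `[0, c]`: integrate over the positive, respectively the negative part. -/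
theorem abs_sum_mul_le_of_sets {α : Type*} [Fintype α] {d V : α → ℝ} {c K : ℝ} (hc : 0 ≤ c)
    (hV : ∀ a, V a ∈ Set.Icc 0 c) (hd : ∀ U : Finset α, |∑ a ∈ U, d a| ≤ K) :
    |∑ a, d a * V a| ≤ c * K := by
  have upper : ∀ e : α → ℝ, (∀ U : Finset α, |∑ a ∈ U, e a| ≤ K) → ∑ a, e a * V a ≤ c * K := by
    intro e he
    calc ∑ a, e a * V a ≤ ∑ a, (if 0 < e a then c * e a else 0) := by
          refine Finset.sum_le_sum fun a _ => ?_
          split_ifs with h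
          · rw [mul_comm]; exact mul_le_mul_of_nonneg_right (hV a).2 h.le
          · exact mul_nonpos_of_nonpos_of_nonneg (not_lt.mp h) (hV a).1
      _ = c * ∑ a with 0 < e a, e a := by rw [← Finset.sum_filter, Finset.mul_sum]
      _ ≤ c * K := mul_le_mul_of_nonneg_left ((le_abs_self _).trans (he _)) hc
  rw [abs_le']
  refine ⟨upper d hd, ?_⟩
  have := upper (fun a => -d a) fun U => by rw [Finset.sum_neg_distrib, abs_neg]; exact hd U
  simpa using this

theorem IsConcentrated.abs_sum_transEst_sub_le (hD : IsConcentrated M obs T δ D t)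
    (hL : 1 / 2 ≤ bonusLog S A H m T δ) (h : Fin H) (s : S) (a : A) (V : S → ℝ)
    (hV : ∀ s', V s' ∈ Set.Icc (0 : ℝ) H) :
    |∑ s', transEst D t h s a s' * V s' - ∑ s', M.trans h s a s' * V s'| ≤
      transBonus m T δ D t h s a := by
  have hv := sum_mul_mem_Icc (M.trans_mem h s a) hV
  have hS : (1 : ℝ) ≤ Fintype.card S := by exact_mod_cast Fintype.card_pos_iff.mpr ⟨s⟩
  have htot := sum_transEst_eq D t h s a Finset.univ
  simp only [Finset.mem_univ, if_true, mul_one] at htot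
  rw [← visits_eq_sum] at htot
  rcases Nat.eq_zero_or_pos (visits D t h s a) with h0 | hpos
  · rw [h0, Nat.cast_zero, zero_div] at htot
    have hz : ∀ s', transEst D t h s a s' = 0 := fun s' =>
      (Finset.sum_eq_zero_iff_of_nonneg fun s' _ => transEst_nonneg D t h s a s').mp htot s'
        (Finset.mem_univ s')
    simp only [hz, zero_mul, Finset.sum_const_zero, zero_sub, abs_neg]
    rw [abs_of_nonneg hv.1, transBonus, h0]
    refine le_min (hv.2.trans (Real.le_sqrt_of_sq_le ?_)) hv.2
    simp only [Nat.cast_zero, zero_le_one, sup_of_le_right, div_one]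
    have : (1 : ℝ) ≤ 2 * (Fintype.card S * bonusLog S A H m T δ) := by nlinarith
    nlinarith [sq_nonneg (H : ℝ)]
  · have hn : (1 : ℝ) ≤ visits D t h s a := by exact_mod_cast hpos
    have hn0 : (0 : ℝ) < visits D t h s a := by linarith
    rw [max_eq_left hn, div_self hn0.ne'] at htot
    have hsets : ∀ U : Finset S, |∑ s' ∈ U, (transEst D t h s a s' - M.trans h s a s')| ≤
        Real.sqrt (2 * (Fintype.card S * bonusLog S A H m T δ) / visits D t h s a) := by
      intro U
      have hc := hD.trans h s a U hpos
      simp only [fun τ => visitInd_mul_sub h s a (D (τ + 1))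
        (if (D (τ + 1)).state h.succ ∈ U then 1 else 0)
        (fun s a => ∑ s' ∈ U, M.trans h s a s')] at hc
      rw [Finset.sum_sub_distrib, ← Finset.mul_sum, ← visits_eq_sum] at hc
      have e := sum_transEst_eq D t h s a U
      rw [max_eq_left hn] at e
      rw [Finset.sum_sub_distrib, e]
      convert abs_div_le_sqrt_div hn0 hc using 2
      field_simp
    rw [transBonus, max_eq_left hn]
    refine le_min ?_ ?_
    · have := abs_sum_mul_le_of_sets (Nat.cast_nonneg H) hV hsets
      simp only [sub_mul, Finset.sum_sub_distrib] at this
      refine this.trans (le_of_eq ?_)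
      rw [← Real.sqrt_sq (Nat.cast_nonneg H), ← Real.sqrt_mul (sq_nonneg _),
        Real.sqrt_sq (Nat.cast_nonneg H)]
      congr 1
      ring
    · have h1 := sum_mul_mem_Icc ⟨transEst_nonneg D t h s a, htot⟩ hV
      rw [abs_le]
      constructor <;> linarith [hv.1, hv.2, h1.1, h1.2]

theorem IsConcentrated.isAccurate (hD : IsConcentrated M obs T δ D t)
    (hL : 1 / 2 ≤ bonusLog S A H m T δ) : IsAccurate M obs T δ D t :=
  ⟨hD.abs_rewardEst_sub_le hL, hD.abs_sum_transEst_sub_le hL⟩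

/-- The sum of the two bonuses, as a step reward. -/
noncomputable def totalBonus (m T : ℕ) (δ : ℝ) (D : ℕ → Episode S A J H) (t : ℕ) (h : Fin H)
    (s : S) (a : A) : ℝ :=
  rewardBonus m T δ D t h s a + transBonus m T δ D t h s a

theorem totalBonus_mem_Icc (hH : 1 ≤ H) (D : ℕ → Episode S A J H) (t : ℕ) (h : Fin H) (s : S)
    (a : A) : totalBonus m T δ D t h s a ∈ Set.Icc (0 : ℝ) (2 * H) := by
  have hH' : (1 : ℝ) ≤ H := by exact_mod_cast hH
  constructor
  · exact add_nonneg (le_min (Real.sqrt_nonneg _) zero_le_one)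
      (le_min (Real.sqrt_nonneg _) (Nat.cast_nonneg H))
  · have h1 : rewardBonus m T δ D t h s a ≤ 1 := min_le_right _ _
    have h2 : transBonus m T δ D t h s a ≤ H := min_le_right _ _
    unfold totalBonus
    linarith

variable {Ω : Type*} [mΩ : MeasurableSpace Ω] [MeasurableSpace S] [MeasurableSingletonClass S]
  [MeasurableSpace A] [MeasurableSingletonClass A]

variable {μ : Measure Ω} {ℱ : Filtration ℕ mΩ} {π : ℕ → Ω → Policy S A H}
  {E : ℕ → Ω → Episode S A J H}

theorem measurable_visits
    (hE : ∀ t < T, IsSampled M obs μ (ℱ t) (ℱ (t + 1)) (π (t + 1)) (E (t + 1)))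
    (ht : t ≤ T) (h : Fin H) (s : S) (a : A) :
    Measurable[ℱ t] fun ω => (visits (fun τ => E τ ω) t h s a : ℝ) := by
  simp only [visits_eq_sum]
  refine Finset.measurable_sum _ fun τ hτ => ?_
  have hτ' := Finset.mem_range.mp hτ
  have hle : ℱ (τ + 1) ≤ ℱ t := ℱ.mono hτ'
  exact measurable_visitInd (((hE τ (by omega)).state_measurable _).mono hle le_rfl)
    (((hE τ (by omega)).action_measurable _).mono hle le_rfl) s a

theorem measurable_totalBonus
    (hE : ∀ t < T, IsSampled M obs μ (ℱ t) (ℱ (t + 1)) (π (t + 1)) (E (t + 1)))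
    (ht : t ≤ T) (h : Fin H) (s : S) (a : A) :
    Measurable[ℱ t] fun ω => totalBonus m T δ (fun τ => E τ ω) t h s a := by
  have hv := measurable_visits hE ht h s a
  unfold totalBonus rewardBonus transBonus
  exact (((hv.max measurable_const).const_div _).sqrt.min measurable_const).add
    (((hv.max measurable_const).const_div _).sqrt.min measurable_const)

/-- The tail bound behind both concentration statements: `Y` is observed after the action of step
`h`, with conditional mean `f` of the present state and action. -/
theorem measureReal_visitInd_sum_ge_le [IsProbabilityMeasure μ]
    (hE : ∀ t < T, IsSampled M obs μ (ℱ t) (ℱ (t + 1)) (π (t + 1)) (E (t + 1)))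
    {h : Fin H} {s : S} {a : A} {Y : ℕ → Ω → ℝ} {f : S → A → ℝ}
    (hf : ∀ s a, f s a ∈ Set.Icc (0 : ℝ) 1)
    (hYm : ∀ t < T, Measurable[ℱ (t + 1)] (Y t))
    (hY01 : ∀ t < T, ∀ᵐ ω ∂μ, Y t ω ∈ Set.Icc (0 : ℝ) 1)
    (hY : ∀ t < T, CondMean μ (postAction (ℱ t) (E (t + 1)) h) (Y t)
      fun ω => f ((E (t + 1) ω).state h.castSucc) ((E (t + 1) ω).action h))
    {n : ℕ} (ht : t ≤ T) (hn : 1 ≤ n) {L : ℝ} (hL : 0 ≤ L) {σ : ℝ} (hσ : σ ^ 2 = 1) :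
    μ.real {ω | ∑ τ ∈ Finset.range t, visitInd h s a (E (τ + 1) ω) = n ∧
      Real.sqrt (2 * L * n) ≤ σ * ∑ τ ∈ Finset.range t, visitInd h s a (E (τ + 1) ω) *
        (Y τ ω - f ((E (τ + 1) ω).state h.castSucc) ((E (τ + 1) ω).action h))} ≤
      Real.exp (-(4 * L)) := by
  have hn0 : (0 : ℝ) < n := by exact_mod_cast hn
  have key := measureReal_visit_sum_ge_le (μ := μ) ℱ (T := T)
    (m := fun t => postAction (ℱ t) (E (t + 1)) h)
    (B := fun t ω => visitInd h s a (E (t + 1) ω)) (Y := Y)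
    (W := fun t ω => f ((E (t + 1) ω).state h.castSucc) ((E (t + 1) ω).action h))
    (fun t _ => (le_preAction h).trans (preAction_le_postAction h))
    (fun t ht => (hE t ht).postAction_le (ℱ.mono (Nat.le_succ t)) h)
    (fun t _ => measurable_visitInd (m' := postAction (ℱ t) (E (t + 1)) h)
      (measurable_state_postAction h) (measurable_action_postAction h) s a)
    (fun t _ => measurable_apply_of_fintype (m := postAction (ℱ t) (E (t + 1)) h)
      (F := fun ω a => f ((E (t + 1) ω).state h.castSucc) a) (measurable_action_postAction h)
      fun a => (measurable_of_finite fun s => f s a).comp (measurable_state_postAction h))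
    hYm (fun t _ ω => visitInd_eq_zero_or_one h s a _) (fun t _ ω => hf _ _) hY01 hY ht hn
    (Real.sqrt_nonneg (2 * L * n)) hσ
  refine key.trans (le_of_eq ?_)
  rw [Real.sq_sqrt (by positivity)]
  congr 1
  field_simp
  ring

end ConfidenceEvent

section UnionBound

variable {S A J : Type*} [Fintype S] [DecidableEq S] [Fintype A] [DecidableEq A] {H m : ℕ}
  {M : MOMDP S A H m} {obs : J → Fin m} {T t : ℕ} {δ : ℝ}

/-- The confidence event of a stream: all estimates are concentrated, and the expected bonuses of
the policies are not much larger than the bonuses collected along the episodes. -/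
structure IsReliable (M : MOMDP S A H m) (obs : J → Fin m) (T : ℕ) (δ : ℝ)
    (D : ℕ → Episode S A J H) (π : ℕ → Policy S A H) : Prop where
  concentrated : ∀ t < T, IsConcentrated M obs T δ D t
  expected_bonus : ∑ t ∈ Finset.range T, polEval M (π (t + 1)) (totalBonus m T δ D t) 0 M.init ≤
    ∑ t ∈ Finset.range T, ∑ h : Fin H,
      totalBonus m T δ D t h ((D (t + 1)).state h.castSucc) ((D (t + 1)).action h) +
    2 * (H : ℝ) ^ 2 * Real.sqrt (2 * bonusLog S A H m T δ * T)

variable {Ω : Type*} [mΩ : MeasurableSpace Ω] [MeasurableSpace S] [MeasurableSingletonClass S]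
  [MeasurableSpace A] [MeasurableSingletonClass A] {μ : Measure Ω} {ℱ : Filtration ℕ mΩ}
  {π : ℕ → Ω → Policy S A H} {E : ℕ → Ω → Episode S A J H}

/-- Azuma–Hoeffding for the bonuses of whole episodes, which lie in `[0, 2 H²]`: the visit indicator
is constantly one and the information before an episode is the whole history. -/
theorem measureReal_expected_bonus_gt_le [IsProbabilityMeasure μ] (hH : 1 ≤ H) (hT : 1 ≤ T)
    (hL : 0 ≤ bonusLog S A H m T δ)
    (hE : ∀ t < T, IsSampled M obs μ (ℱ t) (ℱ (t + 1)) (π (t + 1)) (E (t + 1))) :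
    μ.real {ω | ∑ t ∈ Finset.range T, ∑ h : Fin H,
      totalBonus m T δ (fun τ => E τ ω) t h ((E (t + 1) ω).state h.castSucc)
        ((E (t + 1) ω).action h) + 2 * (H : ℝ) ^ 2 * Real.sqrt (2 * bonusLog S A H m T δ * T) <
      ∑ t ∈ Finset.range T, polEval M (π (t + 1) ω)
        (totalBonus m T δ (fun τ => E τ ω) t) 0 M.init} ≤
      Real.exp (-(4 * bonusLog S A H m T δ)) := by
  have hH' : (1 : ℝ) ≤ H := by exact_mod_cast hH
  have hT' : (1 : ℝ) ≤ T := by exact_mod_cast hT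
  have hH2 : (0 : ℝ) < 2 * (H : ℝ) ^ 2 := by positivity
  -- The rescaled bonuses, with totals in `[0, 1]`.
  set f : ℕ → Ω → Fin H → S → A → ℝ := fun t ω h s a =>
    (2 * (H : ℝ) ^ 2)⁻¹ * totalBonus m T δ (fun τ => E τ ω) t h s a with hf
  have hfm : ∀ t ≤ T, ∀ h s a, Measurable[ℱ t] fun ω => f t ω h s a := fun t ht h s a =>
    (measurable_totalBonus hE ht h s a).const_mul _
  have hf01 : ∀ t ω h s a, f t ω h s a ∈ Set.Icc (0 : ℝ) (H : ℝ)⁻¹ := by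
    intro t ω h s a
    have := totalBonus_mem_Icc (m := m) (T := T) (δ := δ) hH (fun τ => E τ ω) t h s a
    refine ⟨mul_nonneg (inv_nonneg.mpr hH2.le) this.1, ?_⟩
    refine (mul_le_mul_of_nonneg_left this.2 (inv_nonneg.mpr hH2.le)).trans (le_of_eq ?_)
    field_simp
  have hY01 : ∀ t ω, ∑ h : Fin H, f t ω h ((E (t + 1) ω).state h.castSucc)
      ((E (t + 1) ω).action h) ∈ Set.Icc (0 : ℝ) 1 := by
    intro t ω
    refine ⟨Finset.sum_nonneg fun h _ => (hf01 _ _ _ _ _).1, ?_⟩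
    refine (Finset.sum_le_sum fun h _ => (hf01 _ _ _ _ _).2).trans (le_of_eq ?_)
    simp [mul_inv_cancel₀ (show (H : ℝ) ≠ 0 by positivity)]
  have hW01 : ∀ t ω, polEval M (π (t + 1) ω) (f t ω) 0 M.init ∈ Set.Icc (0 : ℝ) 1 := by
    intro t ω
    have := polEval_mem_Icc M (π (t + 1) ω) (hf01 t ω) 0 M.init
    simpa [inv_mul_cancel₀ (show (H : ℝ) ≠ 0 by positivity)] using this
  have hfF : ∀ t < T, Measurable[ℱ (t + 1)] fun ω => ∑ h : Fin H,
      f t ω h ((E (t + 1) ω).state h.castSucc) ((E (t + 1) ω).action h) := fun t ht =>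
    Finset.measurable_sum _ fun h _ => measurable_apply_of_fintype (m := ℱ (t + 1))
      (F := fun ω a => f t ω h ((E (t + 1) ω).state h.castSucc) a) ((hE t ht).action_measurable h)
      fun a => measurable_apply_of_fintype (m := ℱ (t + 1)) (F := fun ω s => f t ω h s a)
        ((hE t ht).state_measurable _)
        fun s => (hfm t ht.le h s a).mono (ℱ.mono (Nat.le_succ t)) le_rfl
  have key := measureReal_visit_sum_ge_le (μ := μ) ℱ (T := T) (m := fun t => ℱ t)
    (B := fun _ _ => 1) (Y := fun t ω => ∑ h : Fin H, f t ω h ((E (t + 1) ω).state h.castSucc)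
      ((E (t + 1) ω).action h)) (W := fun t ω => polEval M (π (t + 1) ω) (f t ω) 0 M.init)
    (fun t _ => le_rfl) (fun t _ => ℱ.mono (Nat.le_succ t)) (fun t _ => measurable_const)
    (fun t ht => (hE t ht).measurable_polEval (hfm t ht.le) 0 M.init) hfF
    (fun t _ ω => Or.inr rfl) (fun t _ => hW01 t) (fun t _ => ae_of_all _ (hY01 t))
    (fun t ht => (hE t ht).condMean_total (ℱ.mono (Nat.le_succ t)) (ℱ.le _) (hfm t ht.le)
      (hf01 t)) le_rfl hT (Real.sqrt_nonneg (2 * bonusLog S A H m T δ * T)) (σ := -1) (by norm_num)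
  have e : 2 * Real.sqrt (2 * bonusLog S A H m T δ * T) ^ 2 / T = 4 * bonusLog S A H m T δ := by
    rw [Real.sq_sqrt (by positivity)]
    field_simp
    ring
  rw [e] at key
  refine (measureReal_mono ?_).trans key
  intro ω hω
  refine ⟨by simp, ?_⟩
  simp only [Set.mem_ofPred_eq] at hω
  simp only [hf, polEval_const_mul, ← Finset.mul_sum, one_mul, Finset.sum_sub_distrib,
    neg_mul, neg_sub]
  rw [← mul_sub]
  have h3 := mul_le_mul_of_nonneg_left hω.le (inv_nonneg.mpr hH2.le)
  rw [mul_add, ← mul_assoc, inv_mul_cancel₀ hH2.ne', one_mul] at h3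
  linarith

/-- The union bound over rounds, visit counts, visited pairs and observed quantities (rewards, or
sets of next states); two-sided deviations are indexed by `Bool`. -/
theorem measureReal_not_isReliable_le [Fintype J] [IsProbabilityMeasure μ] (hH : 1 ≤ H)
    (hT : 1 ≤ T) (hL : 1 / 2 ≤ bonusLog S A H m T δ)
    (hE : ∀ t < T, IsSampled M obs μ (ℱ t) (ℱ (t + 1)) (π (t + 1)) (E (t + 1))) :
    μ.real {ω | ¬ IsReliable M obs T δ (fun τ => E τ ω) (fun τ => π τ ω)} ≤
      ((T : ℝ) ^ 2 * H * Fintype.card S * Fintype.card A * (2 * Fintype.card J + 4) + 1) *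
        Real.exp (-(4 * bonusLog S A H m T δ)) := by
  set L := bonusLog S A H m T δ with hLdef
  set q := Real.exp (-(4 * L)) with hq
  have hL0 : 0 ≤ L := by linarith
  let sgn : Bool → ℝ := fun b => if b then 1 else -1
  have hsgn : ∀ b, sgn b ^ 2 = 1 := by intro b; cases b <;> simp [sgn]
  let badR : (Fin T × Fin T × Fin H × S × A × J × Bool) → Set Ω := fun ⟨t, n, h, s, a, j, b⟩ =>
    {ω | ∑ τ ∈ Finset.range t, visitInd h s a (E (τ + 1) ω) = ((n + 1 : ℕ) : ℝ) ∧
      Real.sqrt (2 * L * ((n + 1 : ℕ) : ℝ)) ≤ sgn b *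
        ∑ τ ∈ Finset.range t, visitInd h s a (E (τ + 1) ω) * ((E (τ + 1) ω).reward j h -
          M.reward (obs j) h ((E (τ + 1) ω).state h.castSucc) ((E (τ + 1) ω).action h))}
  let badP : (Fin T × Fin T × Fin H × S × A × Finset S × Bool) → Set Ω :=
    fun ⟨t, n, h, s, a, U, b⟩ =>
    {ω | ∑ τ ∈ Finset.range t, visitInd h s a (E (τ + 1) ω) = ((n + 1 : ℕ) : ℝ) ∧
      Real.sqrt (2 * (Fintype.card S * L) * ((n + 1 : ℕ) : ℝ)) ≤ sgn b *
        ∑ τ ∈ Finset.range t, visitInd h s a (E (τ + 1) ω) *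
          ((if (E (τ + 1) ω).state h.succ ∈ U then 1 else 0) -
          ∑ s' ∈ U, M.trans h ((E (τ + 1) ω).state h.castSucc) ((E (τ + 1) ω).action h) s')}
  let badB : Set Ω := {ω | ∑ t ∈ Finset.range T, ∑ h : Fin H,
      totalBonus m T δ (fun τ => E τ ω) t h ((E (t + 1) ω).state h.castSucc)
        ((E (t + 1) ω).action h) + 2 * (H : ℝ) ^ 2 * Real.sqrt (2 * L * T) <
      ∑ t ∈ Finset.range T, polEval M (π (t + 1) ω)
        (totalBonus m T δ (fun τ => E τ ω) t) 0 M.init}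
  let badN : Set Ω := {ω | ¬ ∀ t < T, ∀ j h, (E (t + 1) ω).reward j h ∈ Set.Icc (0 : ℝ) 1}
  have hN : μ.real badN = 0 := by
    have : ∀ᵐ ω ∂μ, ∀ t < T, ∀ j h, (E (t + 1) ω).reward j h ∈ Set.Icc (0 : ℝ) 1 := by
      rw [ae_all_iff]
      intro t
      by_cases ht : t < T
      · filter_upwards [ae_all_iff.mpr fun j => ae_all_iff.mpr fun h =>
          (hE t ht).reward_range j h] with ω hω
        exact fun _ => hω
      · exact ae_of_all _ fun ω h => absurd h ht
    rw [measureReal_def, show μ badN = 0 from this]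
    simp
  have hB : μ.real badB ≤ q := measureReal_expected_bonus_gt_le hH hT hL0 hE
  have hR : ∀ p, μ.real (badR p) ≤ q := by
    rintro ⟨t, n, h, s, a, j, b⟩
    exact measureReal_visitInd_sum_ge_le hE (f := M.reward (obs j) h)
      (Y := fun τ ω => (E (τ + 1) ω).reward j h) (M.reward_mem (obs j) h)
      (fun t ht => (hE t ht).reward_measurable j h) (fun t ht => (hE t ht).reward_range j h)
      (fun t ht => (hE t ht).condMean_reward (ℱ.mono (Nat.le_succ t)) (ℱ.le _) j h)
      t.2.le (Nat.succ_pos n) hL0 (hsgn b)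
  have hP : ∀ p, μ.real (badP p) ≤ Real.exp (-(4 * (Fintype.card S * L))) := by
    rintro ⟨t, n, h, s, a, U, b⟩
    refine measureReal_visitInd_sum_ge_le hE (f := fun s a => ∑ s' ∈ U, M.trans h s a s')
      (Y := fun τ ω => if (E (τ + 1) ω).state h.succ ∈ U then 1 else 0)
      (fun s a => ⟨Finset.sum_nonneg fun s' _ => (M.trans_mem h s a).1 s', ?_⟩)
      (fun t ht => ?_) (fun t _ => ae_of_all _ fun ω => ?_) (fun t ht => ?_)
      t.2.le (Nat.succ_pos n) (by positivity) (hsgn b)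
    · rw [← (M.trans_mem h s a).2]
      exact Finset.sum_le_sum_of_subset_of_nonneg (Finset.subset_univ U)
        fun s' _ _ => (M.trans_mem h s a).1 s'
    · exact (measurable_of_finite fun s' : S => if s' ∈ U then (1 : ℝ) else 0).comp
        ((hE t ht).state_measurable h.succ)
    · split_ifs <;> simp
    · exact (hE t ht).condMean_state_mem (ℱ.mono (Nat.le_succ t)) (ℱ.le _) h U
  have hsub : {ω | ¬ IsReliable M obs T δ (fun τ => E τ ω) (fun τ => π τ ω)} ⊆
      badN ∪ ((⋃ p, badR p) ∪ ((⋃ p, badP p) ∪ badB)) := by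
    intro ω hω
    by_contra hcon
    simp only [Set.mem_union, Set.mem_iUnion, not_or, not_exists] at hcon
    obtain ⟨c1, c2, c3, c4⟩ := hcon
    have c1 : ∀ t < T, ∀ j h, (E (t + 1) ω).reward j h ∈ Set.Icc (0 : ℝ) 1 := not_not.mp c1
    have two : ∀ {x y : ℝ}, (∀ b, ¬ y ≤ sgn b * x) → |x| ≤ y := by
      intro x y hxy
      have h1 := hxy true
      have h2 := hxy false
      simp only [sgn, if_true, Bool.false_eq_true, if_false, not_le] at h1 h2
      rw [abs_le]
      constructor <;> linarith
    have vis : ∀ {t : ℕ}, t < T → ∀ {h s a}, 1 ≤ visits (fun τ => E τ ω) t h s a →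
        ∃ n : Fin T, visits (fun τ => E τ ω) t h s a = n + 1 := by
      intro t ht h s a hv
      have := visits_le (fun τ => E τ ω) t h s a
      exact ⟨⟨visits (fun τ => E τ ω) t h s a - 1, by omega⟩, by simp only; omega⟩
    refine hω ⟨fun t ht => ⟨fun τ hτ => c1 τ (hτ.trans ht), ?_, ?_⟩, not_lt.mp c4⟩
    · intro j h s a hv
      obtain ⟨n, hn⟩ := vis ht hv
      refine two fun b hb => c2 ⟨⟨t, ht⟩, n, h, s, a, j, b⟩ ⟨?_, ?_⟩
      · rw [← hn, visits_eq_sum]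
      · rw [← hn]; exact hb
    · intro h s a U hv
      obtain ⟨n, hn⟩ := vis ht hv
      refine two fun b hb => c3 ⟨⟨t, ht⟩, n, h, s, a, U, b⟩ ⟨?_, ?_⟩
      · rw [← hn, visits_eq_sum]
      · rw [← hn]; exact hb
  have hq2 : 2 ^ Fintype.card S * Real.exp (-(4 * (Fintype.card S * L))) ≤ 2 * q := by
    have e : Real.exp (-(4 * (Fintype.card S * L))) = q ^ Fintype.card S := by
      rw [hq, ← Real.exp_nat_mul]; congr 1; ring
    have hq1 : 2 * q ≤ 1 := by
      have h1 : 2 ≤ Real.exp (4 * L) := by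
        have := Real.add_one_le_exp (4 * L)
        linarith
      have h2 : Real.exp (4 * L) * q = 1 := by rw [hq, ← Real.exp_add]; simp
      nlinarith [Real.exp_pos (-(4 * L))]
    rw [e, ← mul_pow]
    exact pow_le_of_le_one (by positivity) hq1 (Fintype.card_pos_iff.mpr ⟨M.init⟩).ne'
  have hRs : μ.real (⋃ p, badR p) ≤
      (T : ℝ) ^ 2 * H * Fintype.card S * Fintype.card A * (2 * Fintype.card J) * q := by
    refine (measureReal_iUnion_fintype_le _).trans ((Finset.sum_le_sum fun p _ => hR p).trans
      (le_of_eq ?_))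
    simp only [Finset.sum_const, Finset.card_univ, Fintype.card_prod, Fintype.card_fin,
      Fintype.card_bool, nsmul_eq_mul]
    push_cast
    ring
  have hPs : μ.real (⋃ p, badP p) ≤
      (T : ℝ) ^ 2 * H * Fintype.card S * Fintype.card A * 4 * q := by
    refine (measureReal_iUnion_fintype_le _).trans ((Finset.sum_le_sum fun p _ => hP p).trans ?_)
    simp only [Finset.sum_const, Finset.card_univ, Fintype.card_prod, Fintype.card_fin,
      Fintype.card_bool, nsmul_eq_mul, Fintype.card_finset]
    push_cast
    have := mul_le_mul_of_nonneg_left hq2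
      (by positivity : 0 ≤ 2 * ((T : ℝ) ^ 2 * H * Fintype.card S * Fintype.card A))
    linarith
  calc _ ≤ _ := measureReal_mono hsub
    _ ≤ μ.real badN + (μ.real (⋃ p, badR p) + (μ.real (⋃ p, badP p) + μ.real badB)) :=
      (measureReal_union_le _ _).trans (add_le_add le_rfl ((measureReal_union_le _ _).trans
        (add_le_add le_rfl (measureReal_union_le _ _))))
    _ ≤ _ := by rw [hN]; linarith

end UnionBound

/-! ### The regret of a reliable run -/

theorem le_mul_sqrt_of_sq_le {x c y : ℝ} (hc : 0 ≤ c) (h : x ^ 2 ≤ c ^ 2 * y) :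
    x ≤ c * Real.sqrt y := by
  rw [← Real.sqrt_sq hc, ← Real.sqrt_mul (sq_nonneg c)]
  exact Real.le_sqrt_of_sq_le h

section Regret

variable {S A J : Type*} [Fintype S] [DecidableEq S] [Fintype A] [DecidableEq A] {H m : ℕ}
  {M : MOMDP S A H m} {T : ℕ} {δ : ℝ}

/-- Over the rounds of a reliable stream, the optimistic values exceed the true values of the
executed policies by little in total. -/
theorem IsReliable.sum_value_sub_le [Fintype J] {obs : J → Fin m} {D : ℕ → Episode S A J H}
    {π : ℕ → Policy S A H} (hR : IsReliable M obs T δ D π) (hH : 1 ≤ H) (hA : 1 ≤ Fintype.card A)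
    (hL : 1 / 2 ≤ bonusLog S A H m T δ) {c : ℕ → J → ℝ} {V : ℕ → J → Fin (H + 1) → S → ℝ}
    {Q : ℕ → J → Fin H → S → A → ℝ}
    (hP : ∀ t < T, IsPlan m T δ D t (c (t + 1)) (V (t + 1)) (Q (t + 1)) (π (t + 1))) (j : J) :
    ∑ t ∈ Finset.range T, (V (t + 1) j 0 M.init - value M (obs j) (π (t + 1))) ≤
      24 * Real.sqrt ((H : ℝ) ^ 4 * (Fintype.card S : ℝ) ^ 2 * Fintype.card A *
        bonusLog S A H m T δ * T) := by
  have h1 : ∑ t ∈ Finset.range T, (V (t + 1) j 0 M.init - value M (obs j) (π (t + 1))) ≤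
      2 * ∑ t ∈ Finset.range T, polEval M (π (t + 1)) (totalBonus m T δ D t) 0 M.init := by
    rw [Finset.mul_sum]
    refine Finset.sum_le_sum fun t ht => ?_
    have ht := Finset.mem_range.mp ht
    exact (hP t ht).value_sub_le ((hR.concentrated t ht).isAccurate hL) j
  have h2 := hR.expected_bonus
  have h3 : ∑ t ∈ Finset.range T, ∑ h : Fin H,
      totalBonus m T δ D t h ((D (t + 1)).state h.castSucc) ((D (t + 1)).action h) ≤ _ :=
    sum_bonus_le D T δ
  set L := bonusLog S A H m T δ
  have hS : (1 : ℝ) ≤ Fintype.card S := by exact_mod_cast Fintype.card_pos_iff.mpr ⟨M.init⟩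
  have hA' : (1 : ℝ) ≤ Fintype.card A := by exact_mod_cast hA
  have hH' : (1 : ℝ) ≤ H := by exact_mod_cast hH
  have hT' : (0 : ℝ) ≤ T := Nat.cast_nonneg T
  set s : ℝ := (Fintype.card S : ℝ)
  set α : ℝ := (Fintype.card A : ℝ)
  have hL0 : 0 ≤ L := by linarith
  have hHH : (H : ℝ) ^ 2 ≤ (H : ℝ) ^ 4 := pow_le_pow_right₀ hH' (by norm_num)
  have hss : s ≤ s ^ 2 := by nlinarith
  have b1 : Real.sqrt (2 * L) * (H * (3 * Real.sqrt (s * α * T))) ≤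
      9 / 2 * Real.sqrt ((H : ℝ) ^ 4 * s ^ 2 * α * L * T) := by
    refine le_mul_sqrt_of_sq_le (by norm_num) ?_
    rw [mul_pow, mul_pow, mul_pow, Real.sq_sqrt (by positivity), Real.sq_sqrt (by positivity)]
    have : (H : ℝ) ^ 2 * s * (α * L * T) ≤ (H : ℝ) ^ 4 * s ^ 2 * (α * L * T) := by gcongr
    have h0 : 0 ≤ (H : ℝ) ^ 4 * s ^ 2 * (α * L * T) := by positivity
    nlinarith
  have b2 : Real.sqrt (2 * (H : ℝ) ^ 2 * s * L) * (H * (3 * Real.sqrt (s * α * T))) ≤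
      9 / 2 * Real.sqrt ((H : ℝ) ^ 4 * s ^ 2 * α * L * T) := by
    refine le_mul_sqrt_of_sq_le (by norm_num) ?_
    rw [mul_pow, mul_pow, mul_pow, Real.sq_sqrt (by positivity), Real.sq_sqrt (by positivity)]
    have h0 : 0 ≤ (H : ℝ) ^ 4 * s ^ 2 * (α * L * T) := by positivity
    nlinarith
  have b3 : 2 * (H : ℝ) ^ 2 * Real.sqrt (2 * L * T) ≤
      3 * Real.sqrt ((H : ℝ) ^ 4 * s ^ 2 * α * L * T) := by
    refine le_mul_sqrt_of_sq_le (by norm_num) ?_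
    rw [mul_pow, mul_pow, Real.sq_sqrt (by positivity)]
    have : 1 * 1 * ((H : ℝ) ^ 4 * (L * T)) ≤ s ^ 2 * α * ((H : ℝ) ^ 4 * (L * T)) := by
      gcongr
      nlinarith
    have h0 : 0 ≤ (H : ℝ) ^ 4 * (L * T) := by positivity
    nlinarith
  rw [add_mul] at h3
  linarith

/-- The regret of exponential weights with the step size `√(log m / (H² T))`, for gains of range
`3 H`. The gains `g t` are revealed after `w t` has been chosen, so that the bound for the rounds
`0, …, T - 1` is shifted to `1, …, T` at the cost of two terms. -/
theorem stepSize_regret (hH : 1 ≤ H) (hT : 1 ≤ T) {w g : ℕ → Fin m → ℝ}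
    (hg : ∀ t ≤ T, ∀ i, g t i ∈ Set.Icc (-(H : ℝ)) (2 * H))
    (h0 : ∀ i, w 0 i = 1 / (m : ℝ))
    (hs : ∀ t < T, ∀ i, w (t + 1) i =
      w t i * Real.exp (stepSize m H T * g t i) / ∑ j, w t j * Real.exp (stepSize m H T * g t j))
    (i : Fin m) :
    ∑ t ∈ Finset.range T, (g (t + 1) i - ∑ j, w (t + 1) j * g (t + 1) j) ≤
      17 / 8 * Real.sqrt (Real.log m * (H : ℝ) ^ 2 * T) + 6 * H := by
  have : Nonempty (Fin m) := ⟨i⟩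
  have hm : 1 ≤ m := i.pos
  have hH' : (1 : ℝ) ≤ H := by exact_mod_cast hH
  have hT' : (1 : ℝ) ≤ T := by exact_mod_cast hT
  have hm' : (1 : ℝ) ≤ m := by exact_mod_cast hm
  have h0' : ∀ i, w 0 i = 1 / (Fintype.card (Fin m) : ℝ) := by simpa using h0
  have hmem := expWeights_mem_stdSimplex h0' hs
  have hreg := expWeights_regret (a := -(H : ℝ)) (R := 3 * H) (by linarith)
    (fun t ht i => by
      have := hg t ht.le i
      exact ⟨this.1, this.2.trans (by linarith)⟩) h0' hs i
  rw [Fintype.card_fin] at hreg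
  set ℓ := Real.log m with hℓ
  have hℓ0 : 0 ≤ ℓ := Real.log_nonneg hm'
  set η := stepSize m H T with hη
  set y := Real.sqrt (ℓ * (H : ℝ) ^ 2 * T) with hy
  have hη2 : η ^ 2 = ℓ / ((H : ℝ) ^ 2 * T) := Real.sq_sqrt (by positivity)
  have hηy : η * y = ℓ := by
    rw [hη, hy, stepSize, ← Real.sqrt_mul (by positivity)]
    rw [show ℓ / ((H : ℝ) ^ 2 * T) * (ℓ * (H : ℝ) ^ 2 * T) = ℓ ^ 2 by field_simp]
    exact Real.sqrt_sq hℓ0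
  have e1 : (T : ℝ) * (η ^ 2 * (3 * H) ^ 2 / 8) = 9 / 8 * ℓ := by
    rw [hη2]
    field_simp
    ring
  rw [e1] at hreg
  have hmain : ∑ t ∈ Finset.range T, (g t i - ∑ j, w t j * g t j) ≤ 17 / 8 * y := by
    rcases hm.eq_or_lt with h1 | h1
    · subst h1
      have : ∀ t ∈ Finset.range T, g t i - ∑ j, w t j * g t j = 0 := by
        intro t ht
        have hsum := (hmem t (Finset.mem_range.mp ht).le).2
        rw [Fin.sum_univ_one] at hsum ⊢
        rw [hsum, Subsingleton.elim i 0]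
        ring
      rw [Finset.sum_eq_zero this]
      positivity
    · have hℓpos : 0 < ℓ := Real.log_pos (by exact_mod_cast h1)
      have hηpos : 0 < η := Real.sqrt_pos.mpr (by positivity)
      refine le_of_mul_le_mul_left ?_ hηpos
      linarith
  have hdev : ∀ t ≤ T, |g t i - ∑ j, w t j * g t j| ≤ 3 * H := by
    intro t ht
    obtain ⟨hpos, hsum⟩ := hmem t ht
    have h1 : ∑ j, w t j * g t j ≤ ∑ j, w t j * (2 * H) :=
      Finset.sum_le_sum fun j _ => mul_le_mul_of_nonneg_left (hg t ht j).2 (hpos j).le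
    have h2 : ∑ j, w t j * (-(H : ℝ)) ≤ ∑ j, w t j * g t j :=
      Finset.sum_le_sum fun j _ => mul_le_mul_of_nonneg_left (hg t ht j).1 (hpos j).le
    rw [← Finset.sum_mul, hsum] at h1 h2
    have h3 := hg t ht i
    rw [abs_le]
    constructor <;> linarith [h3.1, h3.2]
  have s1 := Finset.sum_range_succ (fun t => g t i - ∑ j, w t j * g t j) T
  have s2 := Finset.sum_range_succ' (fun t => g t i - ∑ j, w t j * g t j) T
  have d1 := abs_le.mp (hdev T le_rfl)
  have d2 := abs_le.mp (hdev 0 (Nat.zero_le _))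
  linarith

variable {Ω : Type*} [mΩ : MeasurableSpace Ω] [MeasurableSpace S] [MeasurableSpace A]
  {μ : Measure Ω} {lam : Fin m → ℝ} {ι : ℝ}

theorem TchRLRun.isPlan_main (R : TchRLRun M lam ι δ T μ) (ω : Ω) {t : ℕ} (ht : t < T) :
    IsPlan m T δ (fun τ => R.mainEp τ ω) t (fun i => R.w (t + 1) ω i * lam i)
      (R.mainV (t + 1) ω) (R.mainQ (t + 1) ω) (R.mainPol (t + 1) ω) :=
  ⟨R.mainV_last t ht ω, R.mainV_step t ht ω, R.mainQ_step t ht ω, R.mainPol_greedy t ht ω⟩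

theorem TchRLRun.isPlan_aux (R : TchRLRun M lam ι δ T μ) (ω : Ω) (i : Fin m) {t : ℕ}
    (ht : t < T) :
    IsPlan m T δ (fun τ => R.auxEp τ i ω) t (fun _ : Unit => 1) (fun _ => R.auxV (t + 1) ω i)
      (fun _ => R.auxQ (t + 1) ω i) (R.auxPol (t + 1) i ω) :=
  ⟨fun _ => R.auxV_last t ht ω i, fun _ => R.auxV_step t ht ω i, fun _ => R.auxQ_step t ht ω i,
    fun h s => by simpa using R.auxPol_greedy t ht ω i h s⟩

/-- The confidence events of all `m + 1` streams of a run. -/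
structure TchRLRun.IsGood (R : TchRLRun M lam ι δ T μ) (ω : Ω) : Prop where
  main : IsReliable M (fun i => i) T δ (fun τ => R.mainEp τ ω) (fun τ => R.mainPol τ ω)
  aux : ∀ i, IsReliable M (fun _ : Unit => i) T δ (fun τ => R.auxEp τ i ω)
    (fun τ => R.auxPol τ i ω)

theorem TchRLRun.tchMix_sub_tch_le_of_isGood [Nonempty A] (R : TchRLRun M lam ι δ T μ)
    (hH : 1 ≤ H) (hT : 1 ≤ T) (hlam : lam ∈ stdSimplex ℝ (Fin m)) (hι0 : 0 < ι) (hι1 : ι ≤ 1)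
    (hL : 1 ≤ bonusLog S A H m T δ) (hLm : Real.log m ≤ bonusLog S A H m T δ)
    {ω : Ω} (hω : R.IsGood ω) (ρ : Policy S A H) :
    tchMix M lam ι T (fun t => R.mainPol t ω) - tch M lam ι ρ ≤
      57 * Real.sqrt ((H : ℝ) ^ 4 * (Fintype.card S : ℝ) ^ 2 * Fintype.card A *
        bonusLog S A H m T δ / T) := by
  have hL' : 1 / 2 ≤ bonusLog S A H m T δ := by linarith
  have hA : 1 ≤ Fintype.card A := Fintype.card_pos
  have hA' : (1 : ℝ) ≤ Fintype.card A := by exact_mod_cast hA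
  have hS : (1 : ℝ) ≤ Fintype.card S := by exact_mod_cast Fintype.card_pos_iff.mpr ⟨M.init⟩
  have hH' : (1 : ℝ) ≤ H := by exact_mod_cast hH
  have hT' : (1 : ℝ) ≤ T := by exact_mod_cast hT
  have hne : Nonempty (Fin m) := by
    by_contra h
    rw [not_nonempty_iff] at h
    simpa using hlam.2
  have hne' : Nonempty (Policy S A H) := policy_nonempty
  have hmain := fun i => hω.main.sum_value_sub_le (V := fun t => R.mainV t ω)
    (Q := fun t => R.mainQ t ω) (c := fun t i => R.w t ω i * lam i) hH hA hL'
    (fun t ht => R.isPlan_main ω ht) i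
  have haux := fun i => (hω.aux i).sum_value_sub_le (V := fun t _ => R.auxV t ω i)
    (Q := fun t _ => R.auxQ t ω i) (c := fun t _ => 1) hH hA hL'
    (fun t ht => R.isPlan_aux ω i ht) ()
  -- Optimism of the auxiliary values and of the weighted main values.
  have hopt : ∀ t < T, ∀ i, optValue M i ≤ R.auxV (t + 1) ω i 0 M.init := by
    intro t ht i
    refine ciSup_le fun π => ?_
    have := (R.isPlan_aux ω i ht).sum_value_le
      (((hω.aux i).concentrated t ht).isAccurate hL') (fun _ => zero_le_one) π
    simpa using this
  set g : ℕ → Fin m → ℝ := fun t i =>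
    lam i * (R.auxV t ω i 0 M.init + ι - R.mainV t ω i 0 M.init) with hg
  have hlam1 : ∀ i, lam i ≤ 1 := fun i => by
    have := abs_le_one_of_mem_stdSimplex hlam i
    exact (le_abs_self _).trans this
  have hVb : ∀ t ≤ T, ∀ i, R.auxV t ω i 0 M.init ∈ Set.Icc (0 : ℝ) H ∧
      R.mainV t ω i 0 M.init ∈ Set.Icc (0 : ℝ) H := by
    intro t ht i
    rcases t with _ | t
    · rw [R.auxV_zero, R.mainV_zero]
      simp
    · exact ⟨(R.isPlan_aux ω i ht).value_mem_Icc_horizon () 0 M.init,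
        (R.isPlan_main ω ht).value_mem_Icc_horizon i 0 M.init⟩
  have hgb : ∀ t ≤ T, ∀ i, g t i ∈ Set.Icc (-(H : ℝ)) (2 * H) := by
    intro t ht i
    obtain ⟨h1, h2⟩ := hVb t ht i
    have l0 := hlam.1 i
    have l1 := hlam1 i
    have x1 : -(H : ℝ) ≤ R.auxV t ω i 0 M.init + ι - R.mainV t ω i 0 M.init := by
      linarith [h1.1, h2.2]
    have x2 : R.auxV t ω i 0 M.init + ι - R.mainV t ω i 0 M.init ≤ 2 * H := by
      linarith [h1.2, h2.1]
    constructor <;> simp only [hg] <;> nlinarith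
  have hregret := stepSize_regret (w := fun t => R.w t ω) (g := g) hH hT hgb (R.w_zero ω)
    (fun t ht i => R.w_succ t ht ω i)
  have hw : ∀ t ≤ T, (∀ i, 0 < R.w t ω i) ∧ ∑ i, R.w t ω i = 1 :=
    expWeights_mem_stdSimplex (w := fun t => R.w t ω) (g := g) (η := stepSize m H T)
      (by simpa using R.w_zero ω) fun t ht i => R.w_succ t ht ω i
  set L := bonusLog S A H m T δ with hLdef
  set Z := Real.sqrt ((H : ℝ) ^ 4 * (Fintype.card S : ℝ) ^ 2 * Fintype.card A * L * T) with hZ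
  have hZ0 : 0 ≤ Z := Real.sqrt_nonneg _
  have hone : (1 : ℝ) ≤ (Fintype.card S : ℝ) ^ 2 * Fintype.card A :=
    one_le_mul_of_one_le_of_one_le (one_le_pow₀ hS) hA'
  have hHH : (H : ℝ) ^ 2 ≤ (H : ℝ) ^ 4 := pow_le_pow_right₀ hH' (by norm_num)
  have hy : Real.sqrt (Real.log m * (H : ℝ) ^ 2 * T) ≤ Z := by
    refine Real.sqrt_le_sqrt ?_
    calc Real.log m * (H : ℝ) ^ 2 * T ≤ L * (H : ℝ) ^ 4 * T * 1 := by
          rw [mul_one]; gcongr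
      _ ≤ L * (H : ℝ) ^ 4 * T * ((Fintype.card S : ℝ) ^ 2 * Fintype.card A) := by gcongr
      _ = _ := by ring
  have hHZ : (H : ℝ) ≤ Z := by
    refine Real.le_sqrt_of_sq_le ?_
    calc (H : ℝ) ^ 2 ≤ (H : ℝ) ^ 4 * (1 * 1 * 1) := by linarith
      _ ≤ (H : ℝ) ^ 4 * (((Fintype.card S : ℝ) ^ 2 * Fintype.card A) * L * T) := by gcongr
      _ = _ := by ring
  -- The gains averaged with the weights are controlled by the comparator.
  have hcomp : ∀ t < T, ∑ j, R.w (t + 1) ω j * g (t + 1) j ≤ tch M lam ι ρ +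
      ∑ j, lam j * (R.auxV (t + 1) ω j 0 M.init - value M j (R.auxPol (t + 1) j ω)) := by
    intro t ht
    obtain ⟨hpos, hsum⟩ := hw (t + 1) ht
    have c1 := (R.isPlan_main ω ht).sum_value_le
      ((hω.main.concentrated t ht).isAccurate hL')
      (fun j => mul_nonneg (hpos j).le (hlam.1 j)) ρ
    have c2 : ∑ j, R.w (t + 1) ω j * (lam j * (optValue M j + ι - value M j ρ)) ≤
        tch M lam ι ρ := by
      calc _ ≤ ∑ j, R.w (t + 1) ω j * tch M lam ι ρ :=
            Finset.sum_le_sum fun j _ => mul_le_mul_of_nonneg_left (le_tch M ρ lam ι j) (hpos j).le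
        _ = _ := by rw [← Finset.sum_mul, hsum, one_mul]
    have c3 : ∑ j, R.w (t + 1) ω j * (lam j * (R.auxV (t + 1) ω j 0 M.init - optValue M j)) ≤
        ∑ j, lam j * (R.auxV (t + 1) ω j 0 M.init - value M j (R.auxPol (t + 1) j ω)) := by
      refine Finset.sum_le_sum fun j _ => ?_
      have o1 := hopt t ht j
      have o2 := value_le_optValue M (R.auxPol (t + 1) j ω) j
      have w1 : R.w (t + 1) ω j ≤ 1 := by
        rw [← hsum]
        exact Finset.single_le_sum (fun k _ => (hpos k).le) (Finset.mem_univ j)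
      refine (mul_le_of_le_one_left (mul_nonneg (hlam.1 j) (by linarith)) w1).trans ?_
      exact mul_le_mul_of_nonneg_left (by linarith) (hlam.1 j)
    have e : ∑ j, R.w (t + 1) ω j * g (t + 1) j =
        ∑ j, R.w (t + 1) ω j * (lam j * (R.auxV (t + 1) ω j 0 M.init - optValue M j)) +
        ∑ j, R.w (t + 1) ω j * (lam j * (optValue M j + ι - value M j ρ)) +
        (∑ j, R.w (t + 1) ω j * lam j * value M j ρ -
          ∑ j, R.w (t + 1) ω j * lam j * R.mainV (t + 1) ω j 0 M.init) := by
      rw [← Finset.sum_sub_distrib, ← Finset.sum_add_distrib, ← Finset.sum_add_distrib]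
      exact Finset.sum_congr rfl fun j _ => by simp only [hg]; ring
    linarith
  have hcompSum : ∑ t ∈ Finset.range T, ∑ j, R.w (t + 1) ω j * g (t + 1) j ≤
      T * tch M lam ι ρ + 24 * Z := by
    refine (Finset.sum_le_sum fun t ht => hcomp t (Finset.mem_range.mp ht)).trans ?_
    rw [Finset.sum_add_distrib, Finset.sum_comm]
    have : ∑ j, ∑ t ∈ Finset.range T,
        lam j * (R.auxV (t + 1) ω j 0 M.init - value M j (R.auxPol (t + 1) j ω)) ≤ 24 * Z := by
      calc _ ≤ ∑ j, lam j * (24 * Z) := by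
            refine Finset.sum_le_sum fun j _ => ?_
            rw [← Finset.mul_sum]
            exact mul_le_mul_of_nonneg_left (haux j) (hlam.1 j)
        _ = _ := by rw [← Finset.sum_mul, hlam.2, one_mul]
    simpa using this
  have hobj : ∀ i, lam i * (optValue M i + ι -
      expReturn M i (mixLaw M T fun t => R.mainPol t ω)) ≤ tch M lam ι ρ + 57 * (Z / T) := by
    intro i
    have hT0 : (0 : ℝ) < T := by linarith
    have hIcc : ∑ t ∈ Finset.Icc 1 T, value M i (R.mainPol t ω) =
        ∑ t ∈ Finset.range T, value M i (R.mainPol (t + 1) ω) := by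
      rw [Finset.range_eq_Ico, Finset.sum_Ico_add' (fun t => value M i (R.mainPol t ω)) 0 T 1]
      rfl
    rw [expReturn_mixLaw, hIcc]
    have e : lam i * (optValue M i + ι -
        1 / (T : ℝ) * ∑ t ∈ Finset.range T, value M i (R.mainPol (t + 1) ω)) =
        (∑ t ∈ Finset.range T,
          lam i * (optValue M i + ι - value M i (R.mainPol (t + 1) ω))) / T := by
      rw [← Finset.mul_sum, Finset.sum_sub_distrib]
      simp
      field_simp
    rw [e, div_le_iff₀ hT0]
    have d1 : ∑ t ∈ Finset.range T, lam i * (optValue M i + ι - value M i (R.mainPol (t + 1) ω)) ≤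
        ∑ t ∈ Finset.range T, (g (t + 1) i - ∑ j, R.w (t + 1) ω j * g (t + 1) j) +
        ∑ t ∈ Finset.range T, ∑ j, R.w (t + 1) ω j * g (t + 1) j +
        lam i * ∑ t ∈ Finset.range T,
          (R.mainV (t + 1) ω i 0 M.init - value M i (R.mainPol (t + 1) ω)) := by
      rw [Finset.mul_sum, ← Finset.sum_add_distrib, ← Finset.sum_add_distrib]
      refine Finset.sum_le_sum fun t ht => ?_
      have := mul_le_mul_of_nonneg_left (hopt t (Finset.mem_range.mp ht) i) (hlam.1 i)
      simp only [hg]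
      linarith
    have d2 : lam i * ∑ t ∈ Finset.range T,
        (R.mainV (t + 1) ω i 0 M.init - value M i (R.mainPol (t + 1) ω)) ≤ 24 * Z :=
      (mul_le_mul_of_nonneg_left (hmain i) (hlam.1 i)).trans
        (mul_le_of_le_one_left (by positivity) (hlam1 i))
    have d3 := hregret i
    have d4 : (tch M lam ι ρ + 57 * (Z / T)) * T = T * tch M lam ι ρ + 57 * Z := by
      field_simp
    rw [d4]
    linarith
  have hZT : Z / T =
      Real.sqrt ((H : ℝ) ^ 4 * (Fintype.card S : ℝ) ^ 2 * Fintype.card A * L / T) := by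
    rw [hZ, div_eq_iff (by positivity), ← Real.sqrt_sq (by positivity : (0 : ℝ) ≤ T),
      ← Real.sqrt_mul' _ (by positivity), Real.sqrt_sq (by positivity : (0 : ℝ) ≤ T)]
    congr 1
    field_simp
  rw [← hZT]
  have := ciSup_le hobj
  unfold tchMix tchLaw
  linarith

end Regret

/-! ### The rate and the sample complexity -/

theorem exp_neg_bonusLog {S A : Type*} [Fintype S] [Fintype A] {H m T : ℕ} {δ X : ℝ}
     (hX : 0 < X) (hδ : 0 < δ)
    (h : X = m * Fintype.card S * Fintype.card A * H * T) :
    Real.exp (-(4 * bonusLog S A H m T δ)) = (δ / (8 * X)) ^ 4 := by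
  have e : 8 * (m : ℝ) * Fintype.card S * Fintype.card A * H * T / δ = 8 * X / δ := by
    rw [h]; ring
  rw [bonusLog, e, show -(4 * Real.log (8 * X / δ)) = ((4 : ℕ) : ℝ) * (-Real.log (8 * X / δ)) by
    push_cast; ring, Real.exp_nat_mul, Real.exp_neg, Real.exp_log (by positivity), inv_div]

theorem one_le_log_eight : 1 ≤ Real.log 8 := by
  rw [Real.le_log_iff_exp_le (by norm_num)]
  linarith [Real.exp_one_lt_d9]

section Main

variable {S A : Type*} [Fintype S] [DecidableEq S] [Fintype A] [DecidableEq A] {H m : ℕ}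
  {M : MOMDP S A H m} {T : ℕ} {δ : ℝ}

variable {Ω : Type*} [mΩ : MeasurableSpace Ω] [MeasurableSpace S] [MeasurableSingletonClass S]
  [MeasurableSpace A] [MeasurableSingletonClass A] {μ : Measure Ω} {lam : Fin m → ℝ} {ι : ℝ}

theorem TchRLRun.measureReal_not_isGood_le [IsProbabilityMeasure μ] [Nonempty A]
    (R : TchRLRun M lam ι δ T μ) (hH : 1 ≤ H) (hm : 1 ≤ m) (hT : 1 ≤ T) (hδ0 : 0 < δ)
    (hδ1 : δ < 1) (hL : 1 ≤ bonusLog S A H m T δ) : μ.real {ω | ¬ R.IsGood ω} ≤ δ := by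
  have hA' : (1 : ℝ) ≤ Fintype.card A := by exact_mod_cast Fintype.card_pos (α := A)
  have hS : (1 : ℝ) ≤ Fintype.card S := by exact_mod_cast Fintype.card_pos_iff.mpr ⟨M.init⟩
  have hH' : (1 : ℝ) ≤ H := by exact_mod_cast hH
  have hT' : (1 : ℝ) ≤ T := by exact_mod_cast hT
  have hm' : (1 : ℝ) ≤ m := by exact_mod_cast hm
  have b1 := measureReal_not_isReliable_le (δ := δ) (E := R.mainEp) (π := R.mainPol) (obs := id)
    hH hT (by linarith) fun t ht => R.mainEp_sampled t ht
  have b2 := fun i : Fin m => measureReal_not_isReliable_le (δ := δ)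
    (E := fun τ ω => R.auxEp τ i ω) (π := fun τ ω => R.auxPol τ i ω) (obs := fun _ : Unit => i)
    hH hT (by linarith) fun t ht => R.auxEp_sampled t ht i
  have hsub : {ω | ¬ R.IsGood ω} ⊆
      {ω | ¬ IsReliable M id T δ (fun τ => R.mainEp τ ω) (fun τ => R.mainPol τ ω)} ∪
      ⋃ i, {ω | ¬ IsReliable M (fun _ : Unit => i) T δ (fun τ => R.auxEp τ i ω)
        (fun τ => R.auxPol τ i ω)} := by
    intro ω hω
    by_contra hcon
    simp only [Set.mem_union, Set.mem_iUnion, Set.mem_ofPred_eq, not_or, not_exists,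
      not_not] at hcon
    exact hω ⟨hcon.1, hcon.2⟩
  have hu := (measureReal_mono hsub).trans ((measureReal_union_le (μ := μ) _ _).trans
    (add_le_add b1 ((measureReal_iUnion_fintype_le _).trans (Finset.sum_le_sum fun i _ => b2 i))))
  refine hu.trans ?_
  simp only [Fintype.card_fin, Fintype.card_unit, Finset.sum_const, Finset.card_univ,
    nsmul_eq_mul, Nat.cast_one]
  set s : ℝ := (Fintype.card S : ℝ)
  set α : ℝ := (Fintype.card A : ℝ)
  set X : ℝ := m * s * α * H * T with hX
  have hX1 : 1 ≤ X :=
    one_le_mul_of_one_le_of_one_le (one_le_mul_of_one_le_of_one_le (one_le_mul_of_one_le_of_one_le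
      (one_le_mul_of_one_le_of_one_le hm' hS) hA') hH') hT'
  rw [exp_neg_bonusLog (by linarith) hδ0 hX]
  set N : ℝ := (T : ℝ) ^ 2 * H * s * α with hN
  have hN1 : 1 ≤ N := one_le_mul_of_one_le_of_one_le (one_le_mul_of_one_le_of_one_le
    (one_le_mul_of_one_le_of_one_le (one_le_pow₀ hT') hH') hS) hA'
  have hmN : m * N ≤ X ^ 2 := by
    have : X ^ 2 = m * N * (m * s * α * H) := by rw [hX, hN]; ring
    rw [this]
    exact le_mul_of_one_le_right (by positivity) (one_le_mul_of_one_le_of_one_le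
      (one_le_mul_of_one_le_of_one_le (one_le_mul_of_one_le_of_one_le hm' hS) hA') hH')
  have hcoef : (N * (2 * m + 4) + 1) + m * (N * (2 * 1 + 4) + 1) ≤ 14 * (m * N) := by nlinarith
  have hq0 : 0 ≤ (δ / (8 * X)) ^ 4 := by positivity
  have hδ4 : δ ^ 4 ≤ δ := pow_le_of_le_one hδ0.le hδ1.le (by norm_num)
  calc (N * (2 * m + 4) + 1) * (δ / (8 * X)) ^ 4 + m * ((N * (2 * 1 + 4) + 1) *
        (δ / (8 * X)) ^ 4)
      = ((N * (2 * m + 4) + 1) + m * (N * (2 * 1 + 4) + 1)) * (δ / (8 * X)) ^ 4 := by ring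
    _ ≤ 14 * X ^ 2 * (δ / (8 * X)) ^ 4 := by gcongr; linarith
    _ = 14 / 4096 * δ ^ 4 / X ^ 2 := by field_simp; norm_num
    _ ≤ 14 / 4096 * δ ^ 4 := div_le_self (by positivity) (one_le_pow₀ hX1)
    _ ≤ δ := by nlinarith

/-- The rate in the number of rounds, against an arbitrary comparator policy. -/
theorem TchRLRun.rate [IsProbabilityMeasure μ] [Nonempty A] (R : TchRLRun M lam ι δ T μ)
    (hH : 1 ≤ H) (hT : 1 ≤ T) (hlam : lam ∈ stdSimplex ℝ (Fin m)) (hι0 : 0 < ι) (hι1 : ι ≤ 1)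
    (hδ0 : 0 < δ) (hδ1 : δ < 1) (ρ : Policy S A H) :
    1 - δ ≤ μ.real {ω | tchMix M lam ι T (fun t => R.mainPol t ω) - tch M lam ι ρ ≤
      114 * Real.sqrt ((H : ℝ) ^ 4 * (Fintype.card S : ℝ) ^ 2 * Fintype.card A *
        Real.log (m * Fintype.card S * Fintype.card A * H * T / δ) / T)} := by
  have hm : 1 ≤ m := by
    rcases Nat.eq_zero_or_pos m with rfl | h
    · simpa using hlam.2
    · exact h
  have hA1 : 1 ≤ Fintype.card A := Fintype.card_pos
  have hS1 : 1 ≤ Fintype.card S := Fintype.card_pos_iff.mpr ⟨M.init⟩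
  have hA' : (1 : ℝ) ≤ Fintype.card A := by exact_mod_cast hA1
  have hS : (1 : ℝ) ≤ Fintype.card S := by exact_mod_cast hS1
  have hH' : (1 : ℝ) ≤ H := by exact_mod_cast hH
  have hT' : (1 : ℝ) ≤ T := by exact_mod_cast hT
  have hm' : (1 : ℝ) ≤ m := by exact_mod_cast hm
  -- For a single action the logarithm may be arbitrarily close to zero.
  rcases hA1.eq_or_lt with hA | hA
  · have : {ω | tchMix M lam ι T (fun t => R.mainPol t ω) - tch M lam ι ρ ≤
        114 * Real.sqrt ((H : ℝ) ^ 4 * (Fintype.card S : ℝ) ^ 2 * Fintype.card A *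
        Real.log (m * Fintype.card S * Fintype.card A * H * T / δ) / T)} = Set.univ := by
      ext ω
      simp only [Set.mem_ofPred_eq, Set.mem_univ, iff_true]
      rw [tchMix_eq_tch_of_card_eq_one M hA.symm hT _ ρ, sub_self]
      positivity
    rw [this, probReal_univ]
    linarith
  have hA2 : (2 : ℝ) ≤ Fintype.card A := by exact_mod_cast hA
  set s : ℝ := (Fintype.card S : ℝ) with hs
  set α : ℝ := (Fintype.card A : ℝ) with hα
  have hmX : (m : ℝ) * 2 ≤ m * s * α * H * T := by
    have : (m : ℝ) * 1 * 2 * 1 * 1 ≤ m * s * α * H * T := by gcongr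
    linarith
  have hX2 : 2 ≤ m * s * α * H * T := by linarith
  set X := m * s * α * H * T with hX
  have hX0 : 0 < X := by linarith
  have hXδ : 2 ≤ X / δ := by
    rw [le_div_iff₀ hδ0]
    nlinarith
  have hLeq : bonusLog S A H m T δ = Real.log 8 + Real.log (X / δ) := by
    rw [bonusLog, ← Real.log_mul (by norm_num) (by positivity)]
    congr 1
    rw [hX]
    ring
  have hlog2 : Real.log 2 ≤ Real.log (X / δ) := Real.log_le_log (by norm_num) hXδ
  have hlog2' : 0 < Real.log 2 := Real.log_pos (by norm_num)
  have hlog8 : Real.log 8 = 3 * Real.log 2 := by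
    rw [show (8 : ℝ) = 2 ^ 3 by norm_num, Real.log_pow]; norm_num
  have hL : 1 ≤ bonusLog S A H m T δ := by
    rw [hLeq]
    linarith [one_le_log_eight]
  have hLm : Real.log m ≤ bonusLog S A H m T δ := by
    have : Real.log m ≤ Real.log (X / δ) := by
      refine Real.log_le_log (by linarith) ?_
      rw [le_div_iff₀ hδ0]
      nlinarith
    rw [hLeq]
    linarith
  have hL4 : bonusLog S A H m T δ ≤ 4 * Real.log (X / δ) := by rw [hLeq]; linarith
  have hgood : {ω | R.IsGood ω} ⊆ {ω | tchMix M lam ι T (fun t => R.mainPol t ω) - tch M lam ι ρ ≤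
      114 * Real.sqrt ((H : ℝ) ^ 4 * s ^ 2 * α * Real.log (X / δ) / T)} := by
    intro ω hω
    refine (R.tchMix_sub_tch_le_of_isGood hH hT hlam hι0 hι1 hL hLm hω ρ).trans ?_
    have : Real.sqrt ((H : ℝ) ^ 4 * s ^ 2 * α * bonusLog S A H m T δ / T) ≤
        2 * Real.sqrt ((H : ℝ) ^ 4 * s ^ 2 * α * Real.log (X / δ) / T) := by
      refine le_mul_sqrt_of_sq_le (by norm_num) ?_
      rw [Real.sq_sqrt (by positivity)]
      calc _ ≤ (H : ℝ) ^ 4 * s ^ 2 * α * (4 * Real.log (X / δ)) / T := by gcongr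
        _ = _ := by ring
    linarith
  have hbad := R.measureReal_not_isGood_le hH hm hT hδ0 hδ1 hL
  -- No measurability is needed here: the events cover the whole space.
  have hcover : (1 : ℝ) ≤ μ.real {ω | R.IsGood ω} + μ.real {ω | ¬ R.IsGood ω} := by
    rw [← probReal_univ (μ := μ)]
    refine (measureReal_mono fun ω _ => ?_).trans (measureReal_union_le _ _)
    exact em (R.IsGood ω)
  have := measureReal_mono (μ := μ) hgood
  linarith

/-- Inverting the rate: `T ≥ 2 a log (2 a Y)` implies `T ≥ a log (Y T)`. -/
theorem mul_log_le_of_le {a Y x : ℝ} (ha : 0 < a) (hY : 0 < Y) (hx : 0 < x)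
    (h : 2 * a * Real.log (2 * a * Y) ≤ x) : a * Real.log (Y * x) ≤ x := by
  have h1 := Real.log_le_sub_one_of_pos (show 0 < x / (2 * a) by positivity)
  have e : Real.log (Y * x) = Real.log (2 * a * Y) + Real.log (x / (2 * a)) := by
    rw [← Real.log_mul (by positivity) (by positivity)]
    congr 1
    field_simp
  have h2 := mul_le_mul_of_nonneg_left h1 ha.le
  have e2 : a * (x / (2 * a) - 1) = x / 2 - a := by field_simp
  rw [e, mul_add]
  linarith

/-- The number of rounds after which the rate is below `ε`. -/
theorem exists_rounds {K H s α m δ ε : ℝ} (hK0 : 1 ≤ K) (hK : 2 * K ^ 2 ≤ 2 ^ 15) (hH : 1 ≤ H)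
    (hs : 1 ≤ s) (hα : 1 ≤ α) (hm : 1 ≤ m) (hδ0 : 0 < δ) (hδ1 : δ < 1) (hε0 : 0 < ε)
    (hε1 : ε ≤ 1) :
    ∃ T₀ : ℕ, 1 ≤ T₀ ∧ (T₀ : ℝ) * (m + 1) ≤ 160 * K ^ 2 * m * H ^ 4 * s ^ 2 * α / ε ^ 2 *
        Real.log (2 * m * s * α * H / (ε * δ)) ∧
      ∀ T : ℕ, T₀ ≤ T →
        K * Real.sqrt (H ^ 4 * s ^ 2 * α * Real.log (m * s * α * H * T / δ) / T) ≤ ε := by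
  set X := m * s * α * H with hX
  have hms : 1 ≤ m * s := one_le_mul_of_one_le_of_one_le hm hs
  have hmsα : 1 ≤ m * s * α := one_le_mul_of_one_le_of_one_le hms hα
  have hX1 : 1 ≤ X := one_le_mul_of_one_le_of_one_le hmsα hH
  have hX0 : 0 < X := by linarith
  set B := 2 * X / (ε * δ) with hB
  have hεδ : ε * δ ≤ 1 := by nlinarith
  have hB2 : 2 ≤ B := by
    rw [hB, le_div_iff₀ (by positivity)]
    nlinarith
  have hB' : 2 * m * s * α * H / (ε * δ) = B := by rw [hB, hX]; ring
  set G := H ^ 4 * s ^ 2 * α with hG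
  have hG1 : 1 ≤ G := one_le_mul_of_one_le_of_one_le
    (one_le_mul_of_one_le_of_one_le (one_le_pow₀ hH) (one_le_pow₀ hs)) hα
  have hGX : G ≤ X ^ 4 := by
    have : X ^ 4 = G * (m ^ 4 * s ^ 2 * α ^ 3) := by rw [hX, hG]; ring
    rw [this]
    exact le_mul_of_one_le_right (by linarith) (one_le_mul_of_one_le_of_one_le
      (one_le_mul_of_one_le_of_one_le (one_le_pow₀ hm) (one_le_pow₀ hs)) (one_le_pow₀ hα))
  set a := K ^ 2 * G / ε ^ 2 with ha
  have ha1 : 1 ≤ a := by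
    rw [ha, le_div_iff₀ (by positivity)]
    have h1 : ε ^ 2 ≤ 1 := pow_le_one₀ hε0.le hε1
    have h2 : 1 ≤ K ^ 2 * G := one_le_mul_of_one_le_of_one_le (one_le_pow₀ hK0) hG1
    linarith
  have hlogB : 0 < Real.log B := Real.log_pos (by linarith)
  have hlogB' : Real.log 2 ≤ Real.log B := Real.log_le_log (by norm_num) hB2
  have hpow : 2 * a * (X / δ) ≤ B ^ 20 := by
    have h1 : 2 * a * (X / δ) ≤ 2 ^ 15 * (X / (ε * δ)) ^ 5 := by
      have e1 : 2 * a * (X / δ) = 2 * K ^ 2 * (G * X / (ε ^ 2 * δ)) := by rw [ha]; field_simp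
      rw [e1]
      refine mul_le_mul hK ?_ (by positivity) (by positivity)
      rw [div_pow]
      have d1 : (ε * δ) ^ 5 ≤ ε ^ 2 * δ := by
        rw [mul_pow]
        exact mul_le_mul (pow_le_pow_of_le_one hε0.le hε1 (by norm_num))
          (pow_le_of_le_one hδ0.le hδ1.le (by norm_num)) (by positivity) (by positivity)
      have d2 : G * X ≤ X ^ 5 := by
        calc G * X ≤ X ^ 4 * X := by gcongr
          _ = _ := by ring
      exact div_le_div₀ (by positivity) d2 (by positivity) d1
    have h2 : X / (ε * δ) ≤ B := by
      rw [hB]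
      gcongr
      linarith
    calc _ ≤ _ := h1
      _ ≤ B ^ 15 * B ^ 5 := by gcongr
      _ = _ := by ring
  have hlog : Real.log (2 * a * (X / δ)) ≤ 20 * Real.log B := by
    have := Real.log_le_log (by positivity) hpow
    rw [Real.log_pow] at this
    exact_mod_cast this
  set x := 40 * a * Real.log B with hx
  have hx1 : 1 ≤ x := by
    have : 1 / 2 ≤ Real.log B := by linarith [Real.log_two_gt_d9]
    nlinarith
  refine ⟨⌈x⌉₊, Nat.one_le_ceil_iff.mpr (by linarith), ?_, ?_⟩
  · have h1 : (⌈x⌉₊ : ℝ) ≤ 2 * x := by linarith [Nat.ceil_lt_add_one (by linarith : 0 ≤ x)]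
    rw [hB']
    calc (⌈x⌉₊ : ℝ) * (m + 1) ≤ 2 * x * (2 * m) := by gcongr; linarith
      _ = _ := by rw [hx, ha, hG]; ring
  · intro T hT
    have hT1 : x ≤ T := (Nat.le_ceil x).trans (by exact_mod_cast hT)
    have hT0 : (0 : ℝ) < T := by linarith
    have hfin := mul_log_le_of_le (a := a) (Y := X / δ) (x := T) (by linarith) (by positivity) hT0
      (by nlinarith)
    rw [show m * s * α * H * T / δ = X / δ * T by rw [hX]; ring]
    rw [← Real.sqrt_sq (by linarith : 0 ≤ K), ← Real.sqrt_mul (sq_nonneg K)]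
    refine Real.sqrt_le_iff.mpr ⟨hε0.le, ?_⟩
    rw [← mul_div_assoc, div_le_iff₀ hT0]
    rw [ha] at hfin
    calc K ^ 2 * (G * Real.log (X / δ * T))
        = ε ^ 2 * (K ^ 2 * G / ε ^ 2 * Real.log (X / δ * T)) := by
          field_simp
      _ ≤ ε ^ 2 * T := by gcongr

end Main

theorem theorem1 :
    ∃ C : ℝ, 0 < C ∧
      ∀ (S A : Type*) [Fintype S] [DecidableEq S] [MeasurableSpace S] [MeasurableSingletonClass S]
        [Fintype A] [DecidableEq A] [MeasurableSpace A] [MeasurableSingletonClass A] [Nonempty A]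
        (H m : ℕ) (_ : 1 ≤ H) (M : MOMDP S A H m)
        (lam : Fin m → ℝ) (_ : lam ∈ stdSimplex ℝ (Fin m))
        (ι : ℝ) (_ : 0 < ι) (_ : ι ≤ 1) (δ : ℝ) (_ : 0 < δ) (_ : δ < 1),
        -- the scalarization has a minimizer
        (∃ πstar : Policy S A H, IsMinOn (tch M lam ι) Set.univ πstar) ∧
        -- the rate in the number of rounds
        (∀ (T : ℕ) (_ : 1 ≤ T) (Ω : Type*) [MeasurableSpace Ω] (μ : Measure Ω)
            [IsProbabilityMeasure μ] (R : TchRLRun M lam ι δ T μ)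
            (πstar : Policy S A H) (_ : IsMinOn (tch M lam ι) Set.univ πstar),
            1 - δ ≤ μ.real {ω |
              tchMix M lam ι T (fun t => R.mainPol t ω) - tch M lam ι πstar ≤
                C * Real.sqrt ((H : ℝ) ^ 4 * (Fintype.card S : ℝ) ^ 2 * Fintype.card A *
                  Real.log (m * Fintype.card S * Fintype.card A * H * T / δ) / T)}) ∧
        -- the sample complexity
        (∀ (ε : ℝ) (_ : 0 < ε) (_ : ε ≤ 1),
          ∃ T₀ : ℕ, 1 ≤ T₀ ∧
            (numEpisodes m T₀ : ℝ) ≤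
              C * m * (H : ℝ) ^ 4 * (Fintype.card S : ℝ) ^ 2 * Fintype.card A / ε ^ 2 *
                Real.log (2 * m * Fintype.card S * Fintype.card A * H / (ε * δ)) ∧
            ∀ (T : ℕ) (_ : T₀ ≤ T) (Ω : Type*) [MeasurableSpace Ω] (μ : Measure Ω)
              [IsProbabilityMeasure μ] (R : TchRLRun M lam ι δ T μ)
              (πstar : Policy S A H) (_ : IsMinOn (tch M lam ι) Set.univ πstar),
              1 - δ ≤ μ.real {ω |
                tchMix M lam ι T (fun t => R.mainPol t ω) - tch M lam ι πstar ≤ ε}) := by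

  refine ⟨160 * 114 ^ 2, by norm_num, ?_⟩
  intro S A _ _ _ _ _ _ _ _ _ H m hH M lam hlam ι hι0 hι1 δ hδ0 hδ1
  have hm : 0 < m := by
    rcases Nat.eq_zero_or_pos m with rfl | h
    · simpa using hlam.2
    · exact h
  refine ⟨exists_isMinOn_tch M hm lam ι, ?_, ?_⟩
  · intro T hT Ω _ μ _ R ρ _
    refine (R.rate hH hT hlam hι0 hι1 hδ0 hδ1 ρ).trans (measureReal_mono fun ω hω => ?_)
    exact le_trans hω
      (mul_le_mul_of_nonneg_right (by norm_num) (Real.sqrt_nonneg _))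
  · intro ε hε0 hε1
    obtain ⟨T₀, hT₀, hnum, hrate⟩ := exists_rounds (K := 114) (H := H) (s := Fintype.card S)
      (α := Fintype.card A) (m := m) (by norm_num) (by norm_num) (by exact_mod_cast hH)
      (by exact_mod_cast Fintype.card_pos_iff.mpr ⟨M.init⟩)
      (by exact_mod_cast Fintype.card_pos (α := A)) (by exact_mod_cast hm) hδ0 hδ1 hε0 hε1
    refine ⟨T₀, hT₀, ?_, ?_⟩
    · simpa [numEpisodes] using hnum
    · intro T hT Ω _ μ _ R ρ _
      refine (R.rate hH (hT₀.trans hT) hlam hι0 hι1 hδ0 hδ1 ρ).trans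
        (measureReal_mono fun ω hω => ?_)
      exact le_trans hω (hrate T hT)
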